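/- Let $\alpha,\gamma>0$, let $a\in C^7[0,1]$ and $b,f\in C^9[0,1]$ be real-valued with $a(x)>\alpha$ and $b(x)>\gamma a(x)$ for $x\in(0,1)$. For $0<\varepsilon\le 1$ and $0\le\mu\le 1$ put $$L_{\varepsilon,\mu}z:=-\varepsilon z''+\mu a z'+bz,\qquad \theta:=\max\Bigl\{1,\frac{\alpha\mu^2}{\gamma\varepsilon}\Bigr\}.$$ Then there is a constant $C>0$, depending only on $a,b,f,\alpha,\gamma$ (and not on $\varepsilon,\mu$), such that for all such $\varepsilon,\mu$ there are functions $v,w_L,w_R\in C^5[0,1]$ with the following properties. On $(0,1)$ we have $L_{\varepsilon,\mu}v=f$ and $L_{\varepsilon,\mu}w_L=L_{\varepsilon,\mu}w_R=0$; moreover $w_R(0)=0$, $w_R(1)=1$, $w_L(0)=1$, and $w_L(1)=0$ if $\mu^2\le\gamma\varepsilon/\alpha$ (the values $v(0)$, $v(1)$ and, if $\mu^2>\gamma\varepsilon/\alpha$, $w_L(1)$ are chosen suitably). Every $u\in C^5(0,1)\cap C^0[0,1]$ with $L_{\varepsilon,\mu}u=f$ on $(0,1)$ and $u(0)=u(1)=0$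 decomposes on $[0,1]$ as $$u=v+c_Lw_L+c_Rw_R,\qquad c_L=(u-v)(0),\quad c_R=(u-v)(1)-c_L\,w_L(1).$$ Finally, for all $x\in[0,1]$: (i) $|v^{(k)}(x)|\le C\bigl(1+(\sqrt{\varepsilon/\theta})^{3-k}\bigr)$ for $0\le k\le 5$; (ii) $|w_L(x)|\le C e^{-\frac{\sqrt{\gamma\alpha}}{2\sqrt{\varepsilon\theta}}x}$ and $|w_R(x)|\le C e^{-\frac{\sqrt{\gamma\alpha\theta}}{\sqrt{\varepsilon}}(1-x)}$; (iii) $|w_R^{(k)}(x)|\le C\bigl(\sqrt{\theta/\varepsilon}\bigr)^k e^{-\frac{\sqrt{\gamma\alpha\theta}}{\sqrt{\varepsilon}}(1-x)}$ for $1\le k\le 5$; (iv) $|w_L^{(k)}(x)|\le C\bigl(\tfrac{1}{\sqrt{\varepsilon\theta}}\bigr)^k(1+\theta^{k-3})\,e^{-\frac{\sqrt{\gamma\alpha}}{2\sqrt{\varepsilon\theta}}x}$ for $1\le k\le 5$. -/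

import Mathlib

namespace TwoParam

/-- The differential operator `L z = -ε z'' + μ a z' + b z`, evaluated at points of `(0,1)`. -/
noncomputable def L (ε μ : ℝ) (a b z : ℝ → ℝ) (x : ℝ) : ℝ :=
  -ε * deriv (deriv z) x + μ * a x * deriv z x + b x * z x

/-- The parameter `θ = max {1, α μ² / (γ ε)}`. -/
noncomputable def theta (α γ ε μ : ℝ) : ℝ :=
  max 1 (α * μ ^ 2 / (γ * ε))

/-- The `k`-th derivative on `[0,1]` (one-sided at the end points). -/
noncomputable def D (k : ℕ) (z : ℝ → ℝ) (x : ℝ) : ℝ :=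
  iteratedDerivWithin k z (Set.Icc 0 1) x

/-- `u ∈ C⁵(0,1) ∩ C⁰[0,1]` solves `L u = f` on `(0,1)`, `u(0) = u(1) = 0`. -/
def IsSolution (ε μ : ℝ) (a b f u : ℝ → ℝ) : Prop :=
  ContDiffOn ℝ 5 u (Set.Ioo 0 1) ∧ ContinuousOn u (Set.Icc 0 1) ∧
    (∀ x ∈ Set.Ioo (0 : ℝ) 1, L ε μ a b u x = f x) ∧ u 0 = 0 ∧ u 1 = 0

/-- `z ∈ C⁵[0,1]` and `L z = g` on `(0,1)`; no boundary conditions are imposed. -/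
def IsComponent (ε μ : ℝ) (a b g z : ℝ → ℝ) : Prop :=
  ContDiffOn ℝ 5 z (Set.Icc 0 1) ∧ ∀ x ∈ Set.Ioo (0 : ℝ) 1, L ε μ a b z x = g x

end TwoParam

namespace TwoParam

open Set Filter Topology MeasureTheory
open scoped BoundedContinuousFunction ContDiff

/-! ### Global existence for linear initial value problems. -/

section ODE

variable {E : Type*} [NormedAddCommGroup E] [NormedSpace ℝ E]

/-! Put s = √(εθ), ρ = √(θ/ε) and κ = √(γ/α). Then ερ = s, sρ = θ, μ ≤ κs, and μ = κs when θ > 1.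
The left layer has width of order s, the right layer width of order 1/ρ; for θ = 1 the two widths
agree, for θ > 1 convection makes the right layer thinner.

Values are controlled by the maximum principle (`nonneg_of_L_nonneg`, `abs_le_of_barrier`), which
holds because b > 0, with exponentials or constants as barriers. The same principle gives
uniqueness, hence the decomposition of u, and makes shooting work, hence existence (`exists_bvp`).

Derivatives are then recovered from values. An exponentially weighted bound on z passes to its
derivatives at the price of a factor ρ for each (`WeightedSolution.abs_iteratedDeriv_le`). This
suffices for w_R, and for all components when θ = 1. For θ > 1 the components v and w_L may lose
only 1/s per derivative. To achieve this the coefficients are extended past 1 and both components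
are built from problems on [0, 1 + δ], so that any right layer sits at 1 + δ and is exponentially
small on [0,1]. The differentiated equation is moreover read as a first order equation for the
highest derivative, with data at the right end, and a comparison argument gives the scale 1/μ plus
this remote layer (`WeightedSolution.abs_iteratedDeriv_le_of_transport`).
`abs_iteratedDeriv_le_slow` unites the two cases.

For v, an expansion in μ and ε leaves a residual of size s³. The remainder then has derivatives of
size s^(3-k), and 1/s ≤ ρ turns this into (i). -/

lemma norm_integral_le_exp_of_nonneg {h : ℝ → E} {c l x : ℝ} (hl : 0 < l)
    (hc : 0 ≤ c) (hb : ∀ t, ‖h t‖ ≤ c * Real.exp (l * |t|)) (hx : 0 ≤ x) :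
    ‖∫ t in (0 : ℝ)..x, h t‖ ≤ c / l * Real.exp (l * |x|) := by
  have h1 : ‖∫ t in (0 : ℝ)..x, h t‖ ≤ ∫ t in (0 : ℝ)..x, c * Real.exp (l * t) := by
    refine intervalIntegral.norm_integral_le_of_norm_le hx ?_ ?_
    · refine Eventually.of_forall fun t ht => ?_
      have := hb t
      rwa [abs_of_pos ht.1] at this
    · exact (Continuous.intervalIntegrable (by fun_prop) _ _)
  have h2 : ∫ t in (0 : ℝ)..x, c * Real.exp (l * t) = c / l * (Real.exp (l * x) - 1) := by
    rw [intervalIntegral.integral_eq_sub_of_hasDerivAt (f := fun t => c / l * Real.exp (l * t))]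
    · simp; ring
    · intro t _
      have := ((hasDerivAt_id t).const_mul l).exp.const_mul (c / l)
      exact this.congr_deriv (by simp only [id]; field_simp)
    · exact (Continuous.intervalIntegrable (by fun_prop) _ _)
  rw [h2] at h1
  rw [abs_of_nonneg hx]
  refine h1.trans ?_
  have : 0 ≤ c / l := by positivity
  nlinarith

lemma norm_integral_le_exp {h : ℝ → E} {c l : ℝ} (hl : 0 < l)
    (hc : 0 ≤ c) (hb : ∀ t, ‖h t‖ ≤ c * Real.exp (l * |t|)) (x : ℝ) :
    ‖∫ t in (0 : ℝ)..x, h t‖ ≤ c / l * Real.exp (l * |x|) := by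
  rcases le_total 0 x with hx | hx
  · exact norm_integral_le_exp_of_nonneg hl hc hb hx
  · have := norm_integral_le_exp_of_nonneg (h := fun t => h (-t)) (x := -x) hl hc
      (fun t => by simpa using hb (-t)) (by linarith)
    rw [intervalIntegral.integral_comp_neg, intervalIntegral.integral_symm] at this
    simpa using this

/-- Global existence for a globally Lipschitz, time dependent ODE. -/
theorem exists_global_solution [CompleteSpace E] {A : ℝ → E → E}
    (hA : Continuous (Function.uncurry A)) {K G : ℝ} (hK : 0 ≤ K) (hG : 0 ≤ G)
    (hlip : ∀ t u v, ‖A t u - A t v‖ ≤ K * ‖u - v‖) (h0 : ∀ t, ‖A t 0‖ ≤ G) (z0 : E) :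
    ∃ z : ℝ → E, z 0 = z0 ∧ ∀ t, HasDerivAt z (A t (z t)) t := by
  -- The Picard operator acts on exp(-l|t|) z in the sup norm. Its Lipschitz constant there is K/l <
  -- 1/2, so a fixed point exists on the whole line at once.
  set l : ℝ := 2 * K + 1 with hl
  have hlpos : 0 < l := by positivity
  have hcont : ∀ y : ℝ →ᵇ E, Continuous fun t => A t (Real.exp (l * |t|) • y t) := fun y =>
    hA.comp (continuous_id.prodMk ((by fun_prop : Continuous fun t : ℝ => Real.exp (l * |t|)).smul
      y.continuous))
  have hbd : ∀ (y : ℝ →ᵇ E) t,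
      ‖A t (Real.exp (l * |t|) • y t)‖ ≤ (K * ‖y‖ + G) * Real.exp (l * |t|) := by
    intro y t
    have h1 : ‖A t (Real.exp (l * |t|) • y t)‖ ≤
        ‖A t (Real.exp (l * |t|) • y t) - A t 0‖ + ‖A t 0‖ := by
      simpa using norm_add_le (A t (Real.exp (l * |t|) • y t) - A t 0) (A t 0)
    have h2 := hlip t (Real.exp (l * |t|) • y t) 0
    rw [sub_zero, norm_smul, Real.norm_eq_abs, Real.abs_exp] at h2
    have h3 : 1 ≤ Real.exp (l * |t|) := Real.one_le_exp (by positivity)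
    have h4 : K * (Real.exp (l * |t|) * ‖y t‖) ≤ K * (Real.exp (l * |t|) * ‖y‖) := by
      gcongr
      exact y.norm_coe_le_norm t
    nlinarith [h0 t]
  have hexp : ∀ x : ℝ, Real.exp (-(l * |x|)) * Real.exp (l * |x|) = 1 := fun x => by
    rw [← Real.exp_add]; simp
  let T : (ℝ →ᵇ E) → (ℝ →ᵇ E) := fun y =>
    BoundedContinuousFunction.ofNormedAddCommGroup
      (fun x => Real.exp (-(l * |x|)) • (z0 + ∫ t in (0 : ℝ)..x, A t (Real.exp (l * |t|) • y t)))
      (by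
        have := intervalIntegral.continuous_primitive
          (fun a b => (hcont y).intervalIntegrable a b) 0 (μ := volume)
        fun_prop)
      (‖z0‖ + (K * ‖y‖ + G) / l)
      (by
        intro x
        rw [norm_smul, Real.norm_eq_abs, Real.abs_exp]
        have h1 := norm_integral_le_exp hlpos (by positivity) (hbd y) x
        have h2 := norm_add_le z0 (∫ t in (0 : ℝ)..x, A t (Real.exp (l * |t|) • y t))
        have h3 : Real.exp (-(l * |x|)) ≤ 1 := Real.exp_le_one_iff.2 (by
          have := mul_nonneg hlpos.le (abs_nonneg x); linarith)
        calc _ ≤ Real.exp (-(l * |x|)) * (‖z0‖ + (K * ‖y‖ + G) / l * Real.exp (l * |x|)) := by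
              gcongr; linarith
          _ = Real.exp (-(l * |x|)) * ‖z0‖ + (K * ‖y‖ + G) / l := by
              rw [mul_add, mul_left_comm, hexp, mul_one]
          _ ≤ _ := by nlinarith [norm_nonneg z0])
  have hT : ContractingWith (1 / 2) T := by
    refine ⟨by rw [← NNReal.coe_lt_coe]; norm_num, LipschitzWith.of_dist_le_mul fun y w => ?_⟩
    rw [BoundedContinuousFunction.dist_le (by positivity)]
    intro x
    have e : T y x - T w x = Real.exp (-(l * |x|)) • ∫ t in (0 : ℝ)..x,
        (A t (Real.exp (l * |t|) • y t) - A t (Real.exp (l * |t|) • w t)) := by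
      rw [intervalIntegral.integral_sub ((hcont y).intervalIntegrable _ _)
        ((hcont w).intervalIntegrable _ _)]
      simp only [T, BoundedContinuousFunction.coe_ofNormedAddCommGroup]
      rw [← smul_sub, add_sub_add_left_eq_sub]
    rw [dist_eq_norm, e, norm_smul, Real.norm_eq_abs, Real.abs_exp]
    have h1 := norm_integral_le_exp (c := K * dist y w) hlpos (by positivity)
      (h := fun t => A t (Real.exp (l * |t|) • y t) - A t (Real.exp (l * |t|) • w t))
      (fun t => by
        refine (hlip _ _ _).trans ?_
        rw [← smul_sub, norm_smul, Real.norm_eq_abs, Real.abs_exp, mul_assoc,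
          mul_comm (dist y w)]
        gcongr
        rw [← dist_eq_norm]
        exact BoundedContinuousFunction.dist_coe_le_dist t) x
    calc _ ≤ Real.exp (-(l * |x|)) * (K * dist y w / l * Real.exp (l * |x|)) := by gcongr
      _ = K / l * dist y w := by rw [mul_left_comm, hexp]; ring
      _ ≤ _ := by
        refine mul_le_mul_of_nonneg_right ?_ dist_nonneg
        rw [div_le_iff₀ hlpos, hl]
        push_cast
        linarith
  obtain ⟨y, hy, -⟩ := hT.exists_fixedPoint 0 (edist_ne_top _ _)
  have hz : ∀ x, Real.exp (l * |x|) • y x =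
      z0 + ∫ t in (0 : ℝ)..x, A t (Real.exp (l * |t|) • y t) := by
    intro x
    have : T y x = y x := by rw [hy]
    rw [← this]
    simp only [T, BoundedContinuousFunction.coe_ofNormedAddCommGroup]
    rw [smul_smul, mul_comm, hexp, one_smul]
  refine ⟨fun x => Real.exp (l * |x|) • y x, (hz 0).trans (by simp), fun t => ?_⟩
  have hd := (intervalIntegral.integral_hasDerivAt_right ((hcont y).intervalIntegrable 0 t)
    (hcont y).stronglyMeasurable.stronglyMeasurableAtFilter (hcont y).continuousAt).const_add z0
  exact hd.congr_of_eventuallyEq (Eventually.of_forall hz)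

/-- Global solutions of the initial value problem for a scalar second order linear equation. -/
theorem exists_secondOrder_ivp {p q g : ℝ → ℝ} (hp : Continuous p) (hq : Continuous q)
    (hg : Continuous g) {K : ℝ} (hpK : ∀ x, |p x| ≤ K) (hqK : ∀ x, |q x| ≤ K)
    (hgK : ∀ x, |g x| ≤ K) (c d : ℝ) :
    ∃ z w : ℝ → ℝ, z 0 = c ∧ w 0 = d ∧ (∀ x, HasDerivAt z (w x) x) ∧
      ∀ x, HasDerivAt w (p x * w x + q x * z x + g x) x := by
  have hK : 0 ≤ K := (abs_nonneg _).trans (hpK 0)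
  obtain ⟨Z, hZ0, hZ⟩ := exists_global_solution (E := ℝ × ℝ)
    (A := fun t u => (u.2, p t * u.2 + q t * u.1 + g t)) (K := 2 * K + 1) (G := K)
    (by unfold Function.uncurry; fun_prop) (by positivity) hK
    (by
      intro t u v
      have h1 : |u.1 - v.1| ≤ ‖u - v‖ := norm_fst_le (u - v)
      have h2 : |u.2 - v.2| ≤ ‖u - v‖ := norm_snd_le (u - v)
      have h0 := norm_nonneg (u - v)
      rw [Prod.mk_sub_mk, Prod.norm_mk, Real.norm_eq_abs, Real.norm_eq_abs, max_le_iff]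
      constructor
      · nlinarith
      · have e : p t * u.2 + q t * u.1 + g t - (p t * v.2 + q t * v.1 + g t) =
          p t * (u.2 - v.2) + q t * (u.1 - v.1) := by ring
        rw [e]
        refine (abs_add_le _ _).trans ?_
        rw [abs_mul, abs_mul]
        have := mul_le_mul (hpK t) h2 (abs_nonneg _) hK
        have := mul_le_mul (hqK t) h1 (abs_nonneg _) hK
        nlinarith)
    (by
      intro t
      simp [Prod.norm_mk, hgK t]) (c, d)
  exact ⟨fun x => (Z x).1, fun x => (Z x).2, by simp [hZ0], by simp [hZ0],
    fun x => (hZ x).fst, fun x => (hZ x).snd⟩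

end ODE

/-! ### Extension of functions from [0,1] to the line, with derivative bounds. -/

section Extension

/-- A `C^n` function on `[0,1]` is the restriction of a `C^n` function on the line. -/
theorem exists_contDiff_eqOn (n : ℕ) {f : ℝ → ℝ} (hf : ContDiffOn ℝ n f (Icc 0 1)) :
    ∃ F : ℝ → ℝ, ContDiff ℝ n F ∧ EqOn F f (Icc 0 1) := by
  induction n generalizing f with
  | zero =>
    have hc : ContinuousOn f (Icc 0 1) := hf.continuousOn
    refine ⟨IccExtend zero_le_one ((Icc (0 : ℝ) 1).domRestrict f), ?_, fun x hx => ?_⟩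
    · simpa [contDiff_zero] using
        (continuousOn_iff_continuous_domRestrict.1 hc).Icc_extend' (h := zero_le_one)
    · rw [IccExtend_of_mem _ _ hx]; rfl
  | succ n ih =>
    have hu := uniqueDiffOn_Icc (zero_lt_one' ℝ)
    rw [Nat.cast_add, Nat.cast_one, contDiffOn_succ_iff_derivWithin hu] at hf
    obtain ⟨hd, -, hf'⟩ := hf
    -- Extend the derivative and integrate: one order of smoothness is gained.
    obtain ⟨G, hG, hGe⟩ := ih hf'
    have hF : ∀ x, HasDerivAt (fun x => f 0 + ∫ t in (0 : ℝ)..x, G t) (G x) x := fun x =>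
      (intervalIntegral.integral_hasDerivAt_right (hG.continuous.intervalIntegrable 0 x)
        hG.continuous.stronglyMeasurable.stronglyMeasurableAtFilter
        hG.continuous.continuousAt).const_add _
    refine ⟨fun x => f 0 + ∫ t in (0 : ℝ)..x, G t, ?_, ?_⟩
    · rw [Nat.cast_add, Nat.cast_one, contDiff_succ_iff_deriv]
      refine ⟨fun x => (hF x).differentiableAt, by simp, ?_⟩
      rwa [show deriv (fun x => f 0 + ∫ t in (0 : ℝ)..x, G t) = G from
        funext fun x => (hF x).deriv]
    · refine (convex_Icc (0 : ℝ) 1).eqOn_of_fderivWithin_eq (𝕜 := ℝ)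
        (fun x _ => (hF x).differentiableAt.differentiableWithinAt) hd hu ?_
        (left_mem_Icc.2 zero_le_one) (by simp)
      intro x hx
      have h1 := (hF x).hasDerivWithinAt (s := Icc 0 1)
      rw [hGe hx] at h1
      rw [h1.hasFDerivWithinAt.fderivWithin (hu x hx),
        (hd x hx).hasDerivWithinAt.hasFDerivWithinAt.fderivWithin (hu x hx)]

/-- `F` is `C^n` on the line and its derivatives up to order `n` are bounded by `K`. -/
def BddDeriv (n : ℕ) (K : ℝ) (F : ℝ → ℝ) : Prop :=
  ContDiff ℝ n F ∧ ∀ k ≤ n, ∀ x, |iteratedDeriv k F x| ≤ K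

lemma BddDeriv.nonneg {n : ℕ} {K : ℝ} {F : ℝ → ℝ} (h : BddDeriv n K F) : 0 ≤ K :=
  (abs_nonneg _).trans (h.2 0 (Nat.zero_le _) 0)

lemma BddDeriv.abs_le {n : ℕ} {K : ℝ} {F : ℝ → ℝ} (h : BddDeriv n K F) (x : ℝ) : |F x| ≤ K := by
  simpa using h.2 0 (Nat.zero_le _) x

lemma BddDeriv.mono {n m : ℕ} {K K' : ℝ} {F : ℝ → ℝ} (h : BddDeriv n K F) (hm : m ≤ n)
    (hK : K ≤ K') : BddDeriv m K' F :=
  ⟨h.1.of_le (by exact_mod_cast hm), fun k hk x => (h.2 k (hk.trans hm) x).trans hK⟩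

lemma BddDeriv.add {n : ℕ} {K K' : ℝ} {F G : ℝ → ℝ} (h : BddDeriv n K F)
    (h' : BddDeriv n K' G) : BddDeriv n (K + K') (fun x => F x + G x) := by
  refine ⟨h.1.add h'.1, fun k hk x => ?_⟩
  have hk' : (k : WithTop ℕ∞) ≤ n := by exact_mod_cast hk
  rw [iteratedDeriv_fun_add (h.1.of_le hk').contDiffAt (h'.1.of_le hk').contDiffAt]
  exact (abs_add_le _ _).trans (add_le_add (h.2 k hk x) (h'.2 k hk x))

lemma BddDeriv.const_mul {n : ℕ} {K c C : ℝ} {F : ℝ → ℝ} (h : BddDeriv n K F)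
    (hc : |c| ≤ C) : BddDeriv n (C * K) (fun x => c * F x) := by
  refine ⟨contDiff_const.mul h.1, fun k hk x => ?_⟩
  rw [iteratedDeriv_const_mul_field, abs_mul]
  exact mul_le_mul hc (h.2 k hk x) (abs_nonneg _) ((abs_nonneg _).trans hc)

lemma BddDeriv.deriv {n : ℕ} {K : ℝ} {F : ℝ → ℝ} (h : BddDeriv (n + 1) K F) :
    BddDeriv n K (deriv F) := by
  refine ⟨(contDiff_succ_iff_deriv.1 (by exact_mod_cast h.1)).2.2, fun k hk x => ?_⟩
  rw [← iteratedDeriv_succ']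
  exact h.2 (k + 1) (by omega) x

lemma abs_iteratedDeriv_mul_le {k : ℕ} {F G : ℝ → ℝ} {x K M : ℝ} (hF : ContDiff ℝ k F)
    (hG : ContDiff ℝ k G) (hK : ∀ j ≤ k, |iteratedDeriv j F x| ≤ K)
    (hM : ∀ j ≤ k, |iteratedDeriv j G x| ≤ M) :
    |iteratedDeriv k (F * G) x| ≤ 2 ^ k * K * M := by
  have hK0 : 0 ≤ K := (abs_nonneg _).trans (hK 0 (Nat.zero_le _))
  rw [iteratedDeriv_mul hF.contDiffAt hG.contDiffAt]
  refine (Finset.abs_sum_le_sum_abs _ _).trans ?_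
  have : ∀ i ∈ Finset.range (k + 1),
      |(k.choose i : ℝ) * iteratedDeriv i F x * iteratedDeriv (k - i) G x| ≤
        (k.choose i : ℝ) * (K * M) := by
    intro i hi
    rw [abs_mul, abs_mul, Nat.abs_cast, mul_assoc]
    gcongr
    · exact hK i (by simpa [Nat.lt_succ_iff] using hi)
    · exact hM _ (by omega)
  refine (Finset.sum_le_sum this).trans (le_of_eq ?_)
  rw [← Finset.sum_mul, ← Nat.cast_sum, Nat.sum_range_choose]
  push_cast; ring

/-- Leibniz' rule with the leading term split off. -/
lemma abs_iteratedDeriv_mul_sub_le {k : ℕ} {F G : ℝ → ℝ} {x K M : ℝ} (hF : ContDiff ℝ k F)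
    (hG : ContDiff ℝ k G) (hK : ∀ j ≤ k, |iteratedDeriv j F x| ≤ K) (hM0 : 0 ≤ M)
    (hM : ∀ j < k, |iteratedDeriv j G x| ≤ M) :
    |iteratedDeriv k (F * G) x - F x * iteratedDeriv k G x| ≤ 2 ^ k * K * M := by
  have hK0 : 0 ≤ K := (abs_nonneg _).trans (hK 0 (Nat.zero_le _))
  rw [iteratedDeriv_mul hF.contDiffAt hG.contDiffAt, Finset.sum_range_succ']
  simp only [Nat.choose_zero_right, Nat.cast_one, one_mul, iteratedDeriv_zero, Nat.sub_zero,
    add_sub_cancel_right]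
  refine (Finset.abs_sum_le_sum_abs _ _).trans ?_
  have : ∀ i ∈ Finset.range k,
      |(k.choose (i + 1) : ℝ) * iteratedDeriv (i + 1) F x * iteratedDeriv (k - (i + 1)) G x| ≤
        (k.choose (i + 1) : ℝ) * (K * M) := by
    intro i hi
    have hi' := Finset.mem_range.1 hi
    rw [abs_mul, abs_mul, Nat.abs_cast, mul_assoc]
    gcongr
    · exact hK _ (by omega)
    · exact hM _ (by omega)
  refine (Finset.sum_le_sum this).trans ?_
  rw [← Finset.sum_mul, ← Nat.cast_sum, mul_assoc]
  refine mul_le_mul_of_nonneg_right ?_ (by positivity)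
  have h1 := Nat.sum_range_choose k
  rw [Finset.sum_range_succ'] at h1
  exact_mod_cast (by omega : ∑ i ∈ Finset.range k, k.choose (i + 1) ≤ 2 ^ k)

lemma BddDeriv.mul {n : ℕ} {K K' : ℝ} {F G : ℝ → ℝ} (h : BddDeriv n K F)
    (h' : BddDeriv n K' G) : BddDeriv n (2 ^ n * K * K') (fun x => F x * G x) := by
  refine ⟨h.1.mul h'.1, fun k hk x => ?_⟩
  have hk' : (k : WithTop ℕ∞) ≤ n := by exact_mod_cast hk
  refine (abs_iteratedDeriv_mul_le (h.1.of_le hk') (h'.1.of_le hk')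
    (fun j hj => h.2 j (hj.trans hk) x) (fun j hj => h'.2 j (hj.trans hk) x)).trans ?_
  have := h.nonneg
  have := h'.nonneg
  gcongr
  norm_num

/-- A `C^n` function on `[0,1]` extends to the line with bounded derivatives up to order `n`. -/
theorem exists_bddDeriv_eqOn (n : ℕ) {f : ℝ → ℝ} (hf : ContDiffOn ℝ n f (Icc 0 1)) :
    ∃ (F : ℝ → ℝ) (K : ℝ), BddDeriv n K F ∧ EqOn F f (Icc 0 1) := by
  obtain ⟨F, hF, hFe⟩ := exists_contDiff_eqOn n hf
  -- The bump is 1 on [-2, 2], so values on [0,1] survive, and compact support makes all derivatives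
  -- bounded.
  let φ : ContDiffBump (0 : ℝ) := ⟨2, 3, by norm_num, by norm_num⟩
  have hc : ContDiff ℝ n (fun x => φ x * F x) := φ.contDiff.mul hF
  have hs : HasCompactSupport (fun x => φ x * F x) := φ.hasCompactSupport.mul_right
  have hb : ∀ k ≤ n, ∃ K, ∀ x, |iteratedDeriv k (fun x => φ x * F x) x| ≤ K := by
    intro k hk
    have hsk : HasCompactSupport (iteratedDeriv k (fun x => φ x * F x)) := by
      clear hk
      induction k with
      | zero => simpa using hs
      | succ k ih => rw [iteratedDeriv_succ]; exact ih.deriv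
    obtain ⟨K, hK⟩ := hsk.exists_bound_of_continuous
      (hc.continuous_iteratedDeriv k (by exact_mod_cast hk))
    exact ⟨K, hK⟩
  choose! K hK using hb
  refine ⟨fun x => φ x * F x, ∑ k ∈ Finset.range (n + 1), |K k|, ⟨hc, fun k hk x => ?_⟩,
    fun x hx => ?_⟩
  · refine (hK k hk x).trans ((le_abs_self _).trans ?_)
    exact Finset.single_le_sum (f := fun k => |K k|) (fun _ _ => abs_nonneg _)
      (Finset.mem_range.2 (by omega))
  · have : φ x = 1 := φ.one_of_mem_closedBall (by
      simp only [Metric.mem_closedBall, Real.dist_eq, sub_zero, φ]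
      rw [abs_le]; constructor <;> linarith [hx.1, hx.2])
    simp [this, hFe hx]

end Extension

/-! ### Maximum principle, barriers and the boundary value problem. -/

section MaximumPrinciple

variable {ε μ Y : ℝ} {a b : ℝ → ℝ}

/-- The maximum principle for `L`. -/
theorem nonneg_of_L_nonneg {z : ℝ → ℝ} (hε : 0 < ε) (hY : 0 < Y)
    (hb : ∀ x ∈ Ioo 0 Y, 0 < b x) (hz : ContinuousOn z (Icc 0 Y))
    (hL : ∀ x ∈ Ioo 0 Y, 0 ≤ L ε μ a b z x) (h0 : 0 ≤ z 0) (h1 : 0 ≤ z Y) :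
    ∀ x ∈ Icc 0 Y, 0 ≤ z x := by
  obtain ⟨c, hc, hmin⟩ := isCompact_Icc.exists_isMinOn ⟨0, left_mem_Icc.2 hY.le⟩ hz
  intro x hx
  refine le_trans ?_ (hmin hx)
  by_contra! hneg
  have hc' : c ∈ Ioo 0 Y := by
    refine ⟨lt_of_le_of_ne hc.1 ?_, lt_of_le_of_ne hc.2 ?_⟩
    · rintro rfl; linarith
    · rintro rfl; linarith
  have hnhds : Icc 0 Y ∈ 𝓝 c := Icc_mem_nhds hc'.1 hc'.2
  have hloc : IsLocalMin z c := hmin.isLocalMin hnhds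
  have hd : deriv z c = 0 := hloc.deriv_eq_zero
  -- If z'' were negative at the minimum c, the second derivative test would make c a local maximum
  -- too, so z would be constant near c and z''(c) = 0.
  have hdd : 0 ≤ deriv (deriv z) c := by
    by_contra! h
    have hmax := isLocalMax_of_deriv_deriv_neg h hd (hz.continuousAt hnhds)
    have hconst : z =ᶠ[𝓝 c] fun _ => z c := by
      filter_upwards [hloc, hmax] with y h1 h2 using le_antisymm h2 h1
    have : deriv (deriv z) c = 0 := by
      rw [hconst.deriv.deriv_eq]; simp
    linarith
  have := hL c hc'
  unfold L at this
  rw [hd] at this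
  nlinarith [hb c hc', mul_pos (hb c hc') (neg_pos.2 hneg), mul_nonneg hε.le hdd]

lemma L_eq_of_hasDerivAt {z w : ℝ → ℝ} {x d : ℝ} (hz : ∀ x, HasDerivAt z (w x) x)
    (hw : HasDerivAt w d x) : L ε μ a b z x = -ε * d + μ * a x * w x + b x * z x := by
  have h1 : deriv z = w := funext fun x => (hz x).deriv
  rw [L, h1, hw.deriv]

lemma differentiableAt_deriv_of_contDiffAt {z : ℝ → ℝ} {x : ℝ} (hz : ContDiffAt ℝ 2 z x) :
    DifferentiableAt ℝ (deriv z) x :=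
  ((hz.fderiv_right (m := 1) (by norm_num)).clm_apply
    (contDiffAt_const (c := (1 : ℝ)))).differentiableAt (by norm_num)

lemma L_add {z w : ℝ → ℝ} {x : ℝ} (hz : ContDiffAt ℝ 2 z x) (hw : ContDiffAt ℝ 2 w x) :
    L ε μ a b (fun x => z x + w x) x = L ε μ a b z x + L ε μ a b w x := by
  have e : deriv (fun x => z x + w x) =ᶠ[𝓝 x] fun x => deriv z x + deriv w x := by
    filter_upwards [hz.eventually (by simp), hw.eventually (by simp)] with y h1 h2
    exact deriv_fun_add (h1.differentiableAt (by norm_num)) (h2.differentiableAt (by norm_num))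
  have h1 : DifferentiableAt ℝ (deriv z) x :=
    differentiableAt_deriv_of_contDiffAt hz
  have h2 : DifferentiableAt ℝ (deriv w) x :=
    differentiableAt_deriv_of_contDiffAt hw
  unfold L
  rw [e.deriv_eq, e.eq_of_nhds, deriv_fun_add h1 h2]
  ring

lemma L_const_mul {z : ℝ → ℝ} {x : ℝ} (c : ℝ) :
    L ε μ a b (fun x => c * z x) x = c * L ε μ a b z x := by
  unfold L
  have e : deriv (fun x => c * z x) = fun x => c * deriv z x := by
    funext y; exact deriv_const_mul_field c
  rw [e, deriv_const_mul_field c]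
  ring

/-- Regularity of solutions of `L z = g`. -/
theorem contDiff_of_secondOrder (n : ℕ) {p q g z w : ℝ → ℝ} (hp : ContDiff ℝ n p)
    (hq : ContDiff ℝ n q) (hg : ContDiff ℝ n g) (hz : ∀ x, HasDerivAt z (w x) x)
    (hw : ∀ x, HasDerivAt w (p x * w x + q x * z x + g x) x) :
    ContDiff ℝ (n + 2 : ℕ) z := by
  have hz' : deriv z = w := funext fun x => (hz x).deriv
  have hw' : deriv w = fun x => p x * w x + q x * z x + g x := funext fun x => (hw x).deriv
  have key : ∀ m : ℕ, m ≤ n → ContDiff ℝ (m + 1 : ℕ) w → ContDiff ℝ (m + 2 : ℕ) z := by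
    intro m _ h
    rw [show ((m + 2 : ℕ) : WithTop ℕ∞) = (m + 1 : ℕ) + 1 by push_cast; ring,
      contDiff_succ_iff_deriv]
    exact ⟨fun x => (hz x).differentiableAt, by simp, by rwa [hz']⟩
  have step : ∀ m : ℕ, m ≤ n → ContDiff ℝ m w → ContDiff ℝ m z → ContDiff ℝ (m + 1 : ℕ) w := by
    intro m hm h1 h2
    have hm' : (m : WithTop ℕ∞) ≤ n := by exact_mod_cast hm
    rw [Nat.cast_add, Nat.cast_one, contDiff_succ_iff_deriv]
    refine ⟨fun x => (hw x).differentiableAt, by simp, ?_⟩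
    rw [hw']
    exact (((hp.of_le hm').mul h1).add ((hq.of_le hm').mul h2)).add (hg.of_le hm')
  have main : ∀ m : ℕ, m ≤ n → ContDiff ℝ (m + 1 : ℕ) w := by
    intro m
    induction m with
    | zero =>
      intro h
      refine step 0 h ?_ ?_
      · exact contDiff_zero.2 (continuous_iff_continuousAt.2 fun x => (hw x).continuousAt)
      · exact contDiff_zero.2 (continuous_iff_continuousAt.2 fun x => (hz x).continuousAt)
    | succ m ih =>
      intro h
      have h1 := ih (by omega)
      exact step (m + 1) h h1 ((key m (by omega) h1).of_le (by exact_mod_cast (by omega)))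
  exact key n le_rfl (main n le_rfl)

/-- Solvability of the two point boundary value problem. -/
theorem exists_bvp (n : ℕ) {g : ℝ → ℝ} {K : ℝ} (hε : 0 < ε) (hY : 0 < Y)
    (ha : BddDeriv n K a) (hb : BddDeriv n K b) (hg : BddDeriv n K g)
    (hbp : ∀ x ∈ Ioo 0 Y, 0 < b x) (c d : ℝ) :
    ∃ z : ℝ → ℝ, ContDiff ℝ (n + 2 : ℕ) z ∧ (∀ x, L ε μ a b z x = g x) ∧ z 0 = c ∧ z Y = d := by
  have hK := ha.nonneg
  have hp := (ha.const_mul (le_refl |μ / ε|)).mono le_rfl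
    (le_add_of_nonneg_right (by positivity : 0 ≤ |1 / ε| * K))
  have hq := (hb.const_mul (le_refl |1 / ε|)).mono le_rfl
    (le_add_of_nonneg_left (by positivity : 0 ≤ |μ / ε| * K))
  have h0 : BddDeriv n (|μ / ε| * K + |1 / ε| * K) (fun _ => (0 : ℝ)) :=
    ⟨contDiff_const, fun k _ x => by simp; positivity⟩
  have hr := (hg.const_mul (c := -(1 / ε)) (C := |1 / ε|) (by simp)).mono le_rfl
    (le_add_of_nonneg_left (by positivity : 0 ≤ |μ / ε| * K))
  have hLz : ∀ {z w G : ℝ → ℝ}, (∀ x, HasDerivAt z (w x) x) →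
      (∀ x, HasDerivAt w (μ / ε * a x * w x + 1 / ε * b x * z x + G x) x) →
      ∀ x, L ε μ a b z x = -ε * G x := by
    intro z w G h1 h2 x
    rw [L_eq_of_hasDerivAt h1 (h2 x)]
    field_simp
    ring
  -- Shooting: u solves the homogeneous equation with u(0) = 0, u'(0) = 1, and y the full one with
  -- y(0) = c. Adding a multiple of u reaches d as soon as u(Y) ≠ 0; otherwise the maximum principle
  -- would force u = 0 on [0, Y], against u'(0) = 1.
  obtain ⟨u, u', hu0, hu0', hu, hu'⟩ := exists_secondOrder_ivp hp.1.continuous hq.1.continuous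
    h0.1.continuous hp.abs_le hq.abs_le h0.abs_le 0 1
  obtain ⟨y, y', hy0, -, hy, hy'⟩ := exists_secondOrder_ivp hp.1.continuous hq.1.continuous
    hr.1.continuous hp.abs_le hq.abs_le hr.abs_le c 0
  have hLu := hLz hu hu'
  have hLy := hLz hy hy'
  have hus : ContDiff ℝ (n + 2 : ℕ) u := contDiff_of_secondOrder n hp.1 hq.1 h0.1 hu hu'
  have hys : ContDiff ℝ (n + 2 : ℕ) y := contDiff_of_secondOrder n hp.1 hq.1 hr.1 hy hy'
  have huY : u Y ≠ 0 := by
    intro h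
    have hpos := nonneg_of_L_nonneg (z := u) hε hY hbp hus.continuous.continuousOn
      (fun x _ => by rw [hLu]; simp) hu0.ge h.ge
    have hneg := nonneg_of_L_nonneg (z := fun x => (-1) * u x) hε hY hbp
      (continuous_const.mul hus.continuous).continuousOn
      (fun x _ => by rw [L_const_mul, hLu]; simp) (by simp [hu0]) (by simp [h])
    have hzero : ∀ x ∈ Icc 0 Y, u x = 0 := fun x hx =>
      le_antisymm (by linarith [hneg x hx]) (hpos x hx)
    have h1 : HasDerivWithinAt u 1 (Icc 0 Y) 0 := by
      have := (hu 0).hasDerivWithinAt (s := Icc 0 Y); rwa [hu0'] at this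
    have h2 : HasDerivWithinAt u 0 (Icc 0 Y) 0 :=
      (hasDerivWithinAt_const 0 (Icc 0 Y) (0 : ℝ)).congr hzero (hzero 0 (left_mem_Icc.2 hY.le))
    have := ((uniqueDiffOn_Icc hY) 0 (left_mem_Icc.2 hY.le)).eq_deriv _ h1 h2
    norm_num at this
  refine ⟨fun x => y x + (d - y Y) / u Y * u x, hys.add (contDiff_const.mul hus), fun x => ?_,
    by simp [hy0, hu0], by field_simp; ring⟩
  have h2 : (2 : WithTop ℕ∞) ≤ (n + 2 : ℕ) := by exact_mod_cast (by omega : 2 ≤ n + 2)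
  rw [L_add (hys.of_le h2).contDiffAt (contDiff_const.mul (hus.of_le h2)).contDiffAt,
    L_const_mul, hLu, hLy]
  field_simp
  ring

/-- Comparison with a barrier. -/
theorem abs_le_of_barrier {z Ψ : ℝ → ℝ} (hε : 0 < ε) (hY : 0 < Y)
    (hb : ∀ x ∈ Ioo 0 Y, 0 < b x) (hz : ContDiff ℝ 2 z) (hΨ : ContDiff ℝ 2 Ψ)
    (hL : ∀ x ∈ Ioo 0 Y, |L ε μ a b z x| ≤ L ε μ a b Ψ x) (h0 : |z 0| ≤ Ψ 0)
    (h1 : |z Y| ≤ Ψ Y) : ∀ x ∈ Icc 0 Y, |z x| ≤ Ψ x := by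
  have key : ∀ s : ℝ, |s| = 1 → ∀ x ∈ Icc 0 Y, 0 ≤ Ψ x + s * z x := by
    intro s hs
    have hb' : ∀ t r : ℝ, |t| ≤ r → 0 ≤ r + s * t := fun t r h => by
      have := neg_abs_le (s * t)
      rw [abs_mul, hs, one_mul] at this
      linarith
    refine nonneg_of_L_nonneg (a := a) (μ := μ) hε hY hb
      (hΨ.add (contDiff_const.mul hz)).continuous.continuousOn (fun x hx => ?_)
      (hb' _ _ h0) (hb' _ _ h1)
    rw [L_add hΨ.contDiffAt (contDiff_const.mul hz).contDiffAt, L_const_mul]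
    exact hb' _ _ (hL x hx)
  intro x hx
  rw [abs_le]
  constructor
  · linarith [key 1 (by simp) x hx]
  · linarith [key (-1) (by simp) x hx]

end MaximumPrinciple

/-! ### From weighted bounds on values to weighted bounds on derivatives. -/

section DerivativeEstimates

variable {ε μ : ℝ} {a b g z : ℝ → ℝ}

/-- The differentiated equation. -/
lemma iteratedDeriv_ode {k : ℕ} (ha : ContDiff ℝ k a) (hb : ContDiff ℝ k b)
    (hz : ContDiff ℝ (k + 2 : ℕ) z) (hL : ∀ x, L ε μ a b z x = g x) (x : ℝ) :
    ε * iteratedDeriv (k + 2) z x = μ * iteratedDeriv k (a * deriv z) x +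
      iteratedDeriv k (b * z) x - iteratedDeriv k g x := by
  have hz1 : ContDiff ℝ (k + 1 : ℕ) (deriv z) :=
    (contDiff_succ_iff_deriv.1 (by exact_mod_cast hz)).2.2
  have hz2 : ContDiff ℝ k (deriv (deriv z)) :=
    (contDiff_succ_iff_deriv.1 (by exact_mod_cast hz1)).2.2
  have h1 : ContDiff ℝ k (a * deriv z) := ha.mul (hz1.of_le (by exact_mod_cast (by omega)))
  have h2 : ContDiff ℝ k (b * z) := hb.mul (hz.of_le (by exact_mod_cast (by omega)))
  have hg : g = fun x => (-ε * deriv (deriv z) x + μ * (a * deriv z) x) + (b * z) x := by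
    funext y
    rw [← hL y, L]
    simp only [Pi.mul_apply]
    ring
  have e : iteratedDeriv k g x = -ε * iteratedDeriv k (deriv (deriv z)) x +
      μ * iteratedDeriv k (a * deriv z) x + iteratedDeriv k (b * z) x := by
    rw [hg, iteratedDeriv_fun_add
      ((contDiff_const.mul hz2).add (contDiff_const.mul h1)).contDiffAt h2.contDiffAt,
      iteratedDeriv_fun_add (contDiff_const.mul hz2).contDiffAt
        (contDiff_const.mul h1).contDiffAt,
      iteratedDeriv_const_mul_field, iteratedDeriv_const_mul_field]
  rw [e, iteratedDeriv_succ', iteratedDeriv_succ']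
  ring

/-- A solution of `L z = g` on `[0, Y]` that is bounded by a weight `N exp (β x)`, with
coefficients bounded by `K` and `1 / ρ` the length scale of the steepest layer. -/
structure WeightedSolution (K : ℝ) (a b g z : ℝ → ℝ) (ε μ ρ β Y N : ℝ) : Prop where
  bdd_a : BddDeriv 4 K a
  bdd_b : BddDeriv 4 K b
  contDiff : ContDiff ℝ 6 z
  eq : ∀ x, L ε μ a b z x = g x
  eps_pos : 0 < ε
  mu_nonneg : 0 ≤ μ
  mu_le_one : μ ≤ 1
  one_le_rho : 1 ≤ ρ
  one_le_Y : 1 ≤ Y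
  mu_le : μ ≤ K * ε * ρ
  one_le : 1 ≤ ε * ρ ^ 2
  abs_beta_le : |β| ≤ K * ρ
  bound : ∀ x ∈ Icc 0 Y, |z x| ≤ N * Real.exp (β * x)
  rhs_bound : ∀ k ≤ 4, ∀ x ∈ Icc 0 Y, |iteratedDeriv k g x| ≤ N * Real.exp (β * x)

namespace WeightedSolution

variable {K ρ β Y N : ℝ}

lemma K_nonneg (h : WeightedSolution K a b g z ε μ ρ β Y N) : 0 ≤ K := h.bdd_a.nonneg

lemma N_nonneg (h : WeightedSolution K a b g z ε μ ρ β Y N) : 0 ≤ N := by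
  have := (abs_nonneg _).trans (h.bound 0 ⟨le_rfl, by linarith [h.one_le_Y]⟩)
  simpa using this

lemma contDiff_le (h : WeightedSolution K a b g z ε μ ρ β Y N) {k : ℕ} (hk : k ≤ 6) :
    ContDiff ℝ k z := h.contDiff.of_le (by exact_mod_cast hk)

lemma contDiff_deriv_le (h : WeightedSolution K a b g z ε μ ρ β Y N) {k : ℕ} (hk : k ≤ 5) :
    ContDiff ℝ k (deriv z) := by
  have : ContDiff ℝ (k + 1) z := by exact_mod_cast h.contDiff_le (by omega : k + 1 ≤ 6)
  exact (contDiff_succ_iff_deriv.1 this).2.2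

lemma ode (h : WeightedSolution K a b g z ε μ ρ β Y N) {k : ℕ} (hk : k ≤ 4) (x : ℝ) :
    ε * iteratedDeriv (k + 2) z x = μ * iteratedDeriv k (a * deriv z) x +
      iteratedDeriv k (b * z) x - iteratedDeriv k g x :=
  iteratedDeriv_ode (h.bdd_a.mono hk le_rfl).1 (h.bdd_b.mono hk le_rfl).1
    (h.contDiff_le (by omega)) h.eq x

/-- On an interval of length 1/(2ρ) the weight varies by at most exp(K/2), and the mean value
theorem gives a point ξ with z'(ξ) = O(ρ). From ξ to x one integrates ε z' - μ a z, whose derivative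
b z - μ a' z - g no longer contains z', so no Gronwall factor arises. The bounds μ ≤ Kερ and 1 ≤ ερ²
make every contribution a multiple of ερ. -/
lemma abs_deriv_le (h : WeightedSolution K a b g z ε μ ρ β Y N) {x : ℝ} (hx : x ∈ Icc 0 Y) :
    |deriv z x| ≤ Real.exp (K / 2) * (5 + 2 * K ^ 2 + K) * N * ρ * Real.exp (β * x) := by
  have hK := h.K_nonneg
  have hN := h.N_nonneg
  have hρ : 0 < ρ := by linarith [h.one_le_rho]
  have hε := h.eps_pos
  obtain ⟨p, q, hpq, hp0, hqY, hxp, hxq⟩ : ∃ p q : ℝ, q - p = 1 / (2 * ρ) ∧ 0 ≤ p ∧ q ≤ Y ∧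
      p ≤ x ∧ x ≤ q := by
    have h1 : 1 / (2 * ρ) ≤ 1 / 2 := by
      apply one_div_le_one_div_of_le <;> linarith [h.one_le_rho]
    have h2 : 0 < 1 / (2 * ρ) := by positivity
    have := h.one_le_Y
    -- Since Y ≥ 1 and the length is at most 1/2, the interval fits on one side of x.
    rcases le_total x (1 / 2) with hx' | hx'
    · exact ⟨x, x + 1 / (2 * ρ), by ring, hx.1, by linarith, le_rfl, by linarith⟩
    · exact ⟨x - 1 / (2 * ρ), x, by ring, by linarith, hx.2, by linarith, le_rfl⟩
  have hlt : p < q := by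
    have : 0 < 1 / (2 * ρ) := by positivity
    linarith
  set M : ℝ := N * (Real.exp (K / 2) * Real.exp (β * x)) with hM
  have hM0 : 0 ≤ M := by positivity
  have hW : ∀ y ∈ Icc p q, N * Real.exp (β * y) ≤ M := by
    intro y hy
    rw [hM, ← Real.exp_add]
    gcongr
    have h1 : |y - x| ≤ 1 / (2 * ρ) := by
      rw [abs_le]; constructor <;> linarith [hy.1, hy.2]
    have h2 : β * (y - x) ≤ K / 2 := by
      refine (le_abs_self _).trans ?_
      rw [abs_mul]
      calc _ ≤ K * ρ * (1 / (2 * ρ)) :=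
            mul_le_mul h.abs_beta_le h1 (abs_nonneg _) (by positivity)
        _ = K / 2 := by field_simp
    linarith
  have hsub : Icc p q ⊆ Icc 0 Y := Icc_subset_Icc hp0 hqY
  have hzM : ∀ y ∈ Icc p q, |z y| ≤ M := fun y hy => (h.bound y (hsub hy)).trans (hW y hy)
  have hgM : ∀ y ∈ Icc p q, |g y| ≤ M := fun y hy => by
    simpa using (h.rhs_bound 0 (by norm_num) y (hsub hy)).trans (hW y hy)
  have hzd : ∀ y, HasDerivAt z (deriv z y) y := fun y =>
    (h.contDiff.differentiable (by norm_num) y).hasDerivAt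
  have hzdd : ∀ y, HasDerivAt (deriv z) (deriv (deriv z) y) y := fun y =>
    ((h.contDiff_deriv_le (k := 1) (by norm_num)).differentiable (by norm_num) y).hasDerivAt
  have had : ∀ y, HasDerivAt a (deriv a y) y := fun y =>
    (h.bdd_a.1.differentiable (by norm_num) y).hasDerivAt
  have hda : ∀ y, |deriv a y| ≤ K := fun y => by
    simpa using h.bdd_a.2 1 (by norm_num) y
  obtain ⟨ξ, hξ, hξe⟩ := exists_hasDerivAt_eq_slope z (deriv z) hlt
    h.contDiff.continuous.continuousOn (fun y _ => hzd y)
  have hξM : |deriv z ξ| ≤ 4 * ρ * M := by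
    rw [hξe, hpq, abs_div, abs_of_pos (by positivity : 0 < 1 / (2 * ρ)),
      div_le_iff₀ (by positivity)]
    have h1 := hzM q ⟨hlt.le, le_rfl⟩
    have h2 := hzM p ⟨le_rfl, hlt.le⟩
    calc |z q - z p| ≤ |z q| + |z p| := abs_sub _ _
      _ ≤ 2 * M := by linarith
      _ = _ := by field_simp; ring
  have hΦ : ∀ y, HasDerivAt (fun y => ε * deriv z y - μ * (a y * z y))
      (b y * z y - μ * (deriv a y * z y) - g y) y := by
    intro y
    refine (((hzdd y).const_mul ε).sub (((had y).mul (hzd y)).const_mul μ)).congr_deriv ?_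
    rw [← h.eq y, L]
    ring
  have hΦb : ∀ y ∈ Icc p q, ‖b y * z y - μ * (deriv a y * z y) - g y‖ ≤ (2 * K + 1) * M := by
    intro y hy
    have h1 : |b y * z y| ≤ K * M := by
      rw [abs_mul]; exact mul_le_mul (h.bdd_b.abs_le y) (hzM y hy) (abs_nonneg _) hK
    have h2 : |μ * (deriv a y * z y)| ≤ 1 * (K * M) := by
      rw [abs_mul, abs_mul, abs_of_nonneg h.mu_nonneg]
      exact mul_le_mul h.mu_le_one (mul_le_mul (hda y) (hzM y hy) (abs_nonneg _) hK)
        (by positivity) zero_le_one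
    rw [Real.norm_eq_abs]
    have h3 := abs_sub (b y * z y - μ * (deriv a y * z y)) (g y)
    have h4 := abs_sub (b y * z y) (μ * (deriv a y * z y))
    linarith [hgM y hy]
  have hdiff := (convex_Icc p q).norm_image_sub_le_of_norm_hasDerivWithin_le
    (fun y _ => (hΦ y).hasDerivWithinAt) hΦb (Ioo_subset_Icc_self hξ) ⟨hxp, hxq⟩
  have hxξ : ‖x - ξ‖ ≤ ε * ρ / 2 := by
    have h1 : |x - ξ| ≤ 1 / (2 * ρ) := by
      rw [abs_le]; constructor <;> linarith [hξ.1, hξ.2]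
    refine h1.trans ?_
    rw [div_le_div_iff₀ (by positivity) (by norm_num)]
    nlinarith [h.one_le]
  have haz : ∀ y ∈ Icc p q, |μ * (a y * z y)| ≤ K * ε * ρ * (K * M) := by
    intro y hy
    rw [abs_mul, abs_mul, abs_of_nonneg h.mu_nonneg]
    exact mul_le_mul h.mu_le (mul_le_mul (h.bdd_a.abs_le y) (hzM y hy) (abs_nonneg _) hK)
      (by positivity) (by positivity)
  have h1 := haz x ⟨hxp, hxq⟩
  have h2 := haz ξ (Ioo_subset_Icc_self hξ)
  have h3 : |ε * deriv z x| ≤ ε * (4 * ρ * M) + 2 * (K * ε * ρ * (K * M)) +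
      (2 * K + 1) * M * (ε * ρ / 2) := by
    have e : ε * deriv z x = ((ε * deriv z x - μ * (a x * z x)) -
        (ε * deriv z ξ - μ * (a ξ * z ξ))) + ε * deriv z ξ +
        (μ * (a x * z x) - μ * (a ξ * z ξ)) := by ring
    have h4 : |(ε * deriv z x - μ * (a x * z x)) - (ε * deriv z ξ - μ * (a ξ * z ξ))| ≤
        (2 * K + 1) * M * (ε * ρ / 2) :=
      hdiff.trans (mul_le_mul_of_nonneg_left hxξ (by positivity))
    have h5 : |ε * deriv z ξ| ≤ ε * (4 * ρ * M) := by
      rw [abs_mul, abs_of_pos hε]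
      exact mul_le_mul_of_nonneg_left hξM hε.le
    have h6 := abs_sub (μ * (a x * z x)) (μ * (a ξ * z ξ))
    rw [e]
    refine (abs_add_three _ _ _).trans ?_
    linarith
  rw [abs_mul, abs_of_pos hε] at h3
  have h7 : ε * |deriv z x| ≤ ε * ((5 + 2 * K ^ 2 + K) * ρ * M) := by
    have : 0 ≤ ε * ρ * M := by positivity
    nlinarith
  have h8 := le_of_mul_le_mul_left h7 hε
  rw [hM] at h8
  linarith

/-- Derivatives live on the scale `1 / ρ`. -/
theorem abs_iteratedDeriv_le {K : ℝ} (hK : 0 ≤ K) : ∃ C : ℝ, 1 ≤ C ∧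
    ∀ {a b g z : ℝ → ℝ} {ε μ ρ β Y N : ℝ}, WeightedSolution K a b g z ε μ ρ β Y N →
      ∀ k ≤ 5, ∀ x ∈ Icc 0 Y, |iteratedDeriv k z x| ≤ C * N * ρ ^ k * Real.exp (β * x) := by
  suffices H : ∀ n : ℕ, n ≤ 4 → ∃ C : ℝ, 1 ≤ C ∧
      ∀ {a b g z : ℝ → ℝ} {ε μ ρ β Y N : ℝ}, WeightedSolution K a b g z ε μ ρ β Y N →
      ∀ k ≤ n + 1, ∀ x ∈ Icc 0 Y,
        |iteratedDeriv k z x| ≤ C * N * ρ ^ k * Real.exp (β * x) from H 4 le_rfl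
  intro n
  induction n with
  | zero =>
    intro _
    refine ⟨Real.exp (K / 2) * (5 + 2 * K ^ 2 + K), ?_, ?_⟩
    · have := Real.one_le_exp (by positivity : 0 ≤ K / 2)
      nlinarith [sq_nonneg K]
    · intro a b g z ε μ ρ β Y N h k hk x hx
      have hN := h.N_nonneg
      interval_cases k
      · have h1 : 1 ≤ Real.exp (K / 2) * (5 + 2 * K ^ 2 + K) := by
          have := Real.one_le_exp (by positivity : 0 ≤ K / 2)
          nlinarith [sq_nonneg K]
        have h2 := h.bound x hx
        have h3 : 0 ≤ N * Real.exp (β * x) := by positivity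
        simp only [iteratedDeriv_zero, pow_zero, mul_one]
        nlinarith
      · simpa using h.abs_deriv_le hx
  | succ n ih =>
    intro hn
    obtain ⟨C, hC1, hC⟩ := ih (by omega)
    refine ⟨C + (2 ^ n * K * K * C + 2 ^ n * K * C + 1), by
      have : 0 ≤ 2 ^ n * K * K * C + 2 ^ n * K * C := by positivity
      linarith, ?_⟩
    intro a b g z ε μ ρ β Y N h k hk x hx
    have hN := h.N_nonneg
    have hρ1 := h.one_le_rho
    have hρ : 0 < ρ := by linarith
    have hε := h.eps_pos
    have hb := hC h
    rcases Nat.lt_or_ge k (n + 2) with hk' | hk'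
    · refine (hb k (by omega) x hx).trans ?_
      gcongr
      have : 0 ≤ 2 ^ n * K * K * C + 2 ^ n * K * C := by positivity
      linarith
    obtain rfl : k = n + 2 := by omega
    set P : ℝ := N * Real.exp (β * x) with hP
    have hP0 : 0 ≤ P := by positivity
    have hbound : ∀ m ≤ n + 1, ∀ j ≤ m, |iteratedDeriv j z x| ≤ C * ρ ^ m * P := by
      intro m hm j hj
      refine (hb j (by omega) x hx).trans ?_
      have : ρ ^ j ≤ ρ ^ m := pow_le_pow_right₀ hρ1 hj
      calc C * N * ρ ^ j * Real.exp (β * x) = C * ρ ^ j * P := by rw [hP]; ring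
        _ ≤ _ := by gcongr
    have h1 : |iteratedDeriv n (a * deriv z) x| ≤ 2 ^ n * K * (C * ρ ^ (n + 1) * P) := by
      refine abs_iteratedDeriv_mul_le (h.bdd_a.mono (by omega) le_rfl).1
        (h.contDiff_deriv_le (by omega)) (fun j hj => h.bdd_a.2 j (by omega) x)
        (fun j hj => ?_)
      rw [← iteratedDeriv_succ']
      exact hbound (n + 1) le_rfl (j + 1) (by omega)
    have h2 : |iteratedDeriv n (b * z) x| ≤ 2 ^ n * K * (C * ρ ^ n * P) :=
      abs_iteratedDeriv_mul_le (h.bdd_b.mono (by omega) le_rfl).1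
        (h.contDiff_le (by omega)) (fun j hj => h.bdd_b.2 j (by omega) x)
        (fun j hj => hbound n (by omega) j hj)
    have h3 : |iteratedDeriv n g x| ≤ P := h.rhs_bound n (by omega) x hx
    have h4 : ε * |iteratedDeriv (n + 2) z x| ≤ μ * (2 ^ n * K * (C * ρ ^ (n + 1) * P)) +
        2 ^ n * K * (C * ρ ^ n * P) + P := by
      have e : ε * |iteratedDeriv (n + 2) z x| = |ε * iteratedDeriv (n + 2) z x| := by
        rw [abs_mul, abs_of_pos hε]
      rw [e, h.ode (by omega) x]
      have h5 : |μ * iteratedDeriv n (a * deriv z) x| ≤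
          μ * (2 ^ n * K * (C * ρ ^ (n + 1) * P)) := by
        rw [abs_mul, abs_of_nonneg h.mu_nonneg]
        exact mul_le_mul_of_nonneg_left h1 h.mu_nonneg
      have h6 := abs_sub (μ * iteratedDeriv n (a * deriv z) x + iteratedDeriv n (b * z) x)
        (iteratedDeriv n g x)
      have h7 := abs_add_le (μ * iteratedDeriv n (a * deriv z) x) (iteratedDeriv n (b * z) x)
      linarith
    -- By μ ≤ Kερ and 1 ≤ ερ² each term of the differentiated equation is at most a constant times ε
    -- ρ^(n+2) P, so ε cancels.
    have h5 : μ * (2 ^ n * K * (C * ρ ^ (n + 1) * P)) ≤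
        K * ε * ρ * (2 ^ n * K * (C * ρ ^ (n + 1) * P)) :=
      mul_le_mul_of_nonneg_right h.mu_le (by positivity)
    have h6 : 2 ^ n * K * (C * ρ ^ n * P) ≤ ε * ρ ^ 2 * (2 ^ n * K * (C * ρ ^ n * P)) :=
      le_mul_of_one_le_left (by positivity) h.one_le
    have h7 : P ≤ ε * ρ ^ 2 * (ρ ^ n * P) :=
      (le_mul_of_one_le_left hP0 (one_le_pow₀ hρ1)).trans
        (le_mul_of_one_le_left (by positivity) h.one_le)
    have h8 : ε * |iteratedDeriv (n + 2) z x| ≤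
        ε * ((2 ^ n * K * K * C + 2 ^ n * K * C + 1) * ρ ^ (n + 2) * P) := by
      refine h4.trans ((add_le_add (add_le_add h5 h6) h7).trans (le_of_eq ?_))
      ring
    have h9 := le_of_mul_le_mul_left h8 hε
    refine h9.trans ?_
    have : 0 ≤ C * ρ ^ (n + 2) * P := by positivity
    calc _ ≤ (2 ^ n * K * K * C + 2 ^ n * K * C + 1) * ρ ^ (n + 2) * P +
          C * ρ ^ (n + 2) * P := by linarith
      _ = _ := by rw [hP]; ring

end WeightedSolution

/-- Comparison principle for first order equations, with the data given at the right end. -/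
lemma nonneg_of_firstOrder {h h' : ℝ → ℝ} {Y : ℝ} (hε : 0 < ε) (ha : Continuous a)
    (hd : ∀ x, HasDerivAt h (h' x) x)
    (hineq : ∀ x ∈ Icc 0 Y, 0 ≤ -ε * h' x + μ * a x * h x) (hY : 0 ≤ h Y) :
    ∀ x ∈ Icc 0 Y, 0 ≤ h x := by
  have hI : ∀ x, HasDerivAt (fun x => Real.exp (-(μ / ε) * ∫ t in (0 : ℝ)..x, a t))
      (Real.exp (-(μ / ε) * ∫ t in (0 : ℝ)..x, a t) * (-(μ / ε) * a x)) x := fun x =>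
    ((intervalIntegral.integral_hasDerivAt_right (ha.intervalIntegrable 0 x)
      ha.stronglyMeasurable.stronglyMeasurableAtFilter ha.continuousAt).const_mul _).exp
  -- With this integrating factor F is decreasing, so nonnegativity at Y propagates to the left.
  set F : ℝ → ℝ := fun x => h x * Real.exp (-(μ / ε) * ∫ t in (0 : ℝ)..x, a t) with hF
  have hFd : ∀ x, HasDerivAt F
      (-(1 / ε) * Real.exp (-(μ / ε) * ∫ t in (0 : ℝ)..x, a t) *
        (-ε * h' x + μ * a x * h x)) x := fun x => by
    refine ((hd x).mul (hI x)).congr_deriv ?_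
    field_simp
    ring
  have hanti : AntitoneOn F (Icc 0 Y) := by
    refine antitoneOn_of_deriv_nonpos (convex_Icc 0 Y)
      (fun x _ => (hFd x).continuousAt.continuousWithinAt)
      (fun x _ => (hFd x).differentiableAt.differentiableWithinAt) fun x hx => ?_
    rw [interior_Icc] at hx
    rw [(hFd x).deriv, neg_mul, neg_mul, neg_nonpos]
    exact mul_nonneg (by positivity) (hineq x (Ioo_subset_Icc_self hx))
  intro x hx
  have h1 := hanti hx ⟨hx.1.trans hx.2, le_rfl⟩ hx.2
  have h2 : 0 ≤ F x := le_trans (mul_nonneg hY (Real.exp_pos _).le) h1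
  exact nonneg_of_mul_nonneg_left h2 (Real.exp_pos _)

/-- For `β ≥ 0` and `a ≥ m > 0` the weight `exp (-β x)` and the right layer weight are
supersolutions of the transport part of the operator. -/
lemma transport_supersolution {m A B β σ Y x : ℝ} (hμ : 0 ≤ μ) (hm : m ≤ a x)
    (hσ : ε * σ = m * μ / 2) (hε : 0 < ε) (hβ : 0 ≤ β) (hA : 0 ≤ A) (hB : 0 ≤ B) (hm0 : 0 ≤ m) :
    m * μ / 2 * ((A + B * Real.exp (-(σ * (Y - x)))) * Real.exp (-β * x)) ≤
      -ε * ((B * (Real.exp (-(σ * (Y - x))) * σ)) * Real.exp (-β * x) +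
        (A + B * Real.exp (-(σ * (Y - x)))) * (Real.exp (-β * x) * (-β))) +
      μ * a x * ((A + B * Real.exp (-(σ * (Y - x)))) * Real.exp (-β * x)) := by
  set e := Real.exp (-(σ * (Y - x)))
  set w := Real.exp (-β * x)
  have he : 0 ≤ e := (Real.exp_pos _).le
  have hw : 0 ≤ w := (Real.exp_pos _).le
  have h1 : μ * m * ((A + B * e) * w) ≤ μ * a x * ((A + B * e) * w) := by gcongr
  have h2 : 0 ≤ ε * β * ((A + B * e) * w) := by positivity
  have h3 : 0 ≤ m * μ * (A * w) := by positivity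
  -- The rate σ is half of mμ/ε: the growth of the layer term uses half of the convection and leaves
  -- the margin mμ/2.
  have h4 : -ε * ((B * (e * σ)) * w) = -(m * μ / 2 * (B * e * w)) := by rw [← hσ]; ring
  nlinarith

namespace WeightedSolution

/-- If convection dominates, then derivatives live on the longer scale `1 / l`, away from the
right end. -/
theorem abs_iteratedDeriv_le_of_transport {K m : ℝ} (hK : 0 ≤ K) (hm : 0 < m) :
    ∃ C : ℝ, 1 ≤ C ∧ ∀ {a b g z : ℝ → ℝ} {ε μ ρ β Y N l σ : ℝ},
      WeightedSolution K a b g z ε μ ρ (-β) Y N → 0 ≤ β → (∀ x ∈ Icc 0 Y, m ≤ a x) →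
      μ * l = 1 → 1 ≤ K * μ * ρ → ε * σ = m * μ / 2 →
      ∀ k ≤ 5, ∀ x ∈ Icc 0 Y, |iteratedDeriv k z x| ≤
        C * N * ((l ^ k + ρ ^ k * Real.exp (-(σ * (Y - x)))) * Real.exp (-β * x)) := by
  obtain ⟨D, hD1, hD⟩ := abs_iteratedDeriv_le hK
  suffices H : ∀ n : ℕ, n ≤ 5 → ∃ C : ℝ, 1 ≤ C ∧
      ∀ {a b g z : ℝ → ℝ} {ε μ ρ β Y N l σ : ℝ},
      WeightedSolution K a b g z ε μ ρ (-β) Y N → 0 ≤ β → (∀ x ∈ Icc 0 Y, m ≤ a x) →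
      μ * l = 1 → 1 ≤ K * μ * ρ → ε * σ = m * μ / 2 →
      ∀ k ≤ n, ∀ x ∈ Icc 0 Y, |iteratedDeriv k z x| ≤
        C * N * ((l ^ k + ρ ^ k * Real.exp (-(σ * (Y - x)))) * Real.exp (-β * x)) from
    H 5 le_rfl
  intro n
  induction n with
  | zero =>
    intro _
    refine ⟨1, le_rfl, ?_⟩
    intro a b g z ε μ ρ β Y N l σ h hβ ha hl hρK hσ k hk x hx
    obtain rfl : k = 0 := by omega
    have hN := h.N_nonneg
    simp only [iteratedDeriv_zero, pow_zero, one_mul]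
    refine (h.bound x hx).trans ?_
    gcongr
    refine le_mul_of_one_le_left (by positivity) ?_
    linarith [Real.exp_pos (-(σ * (Y - x)))]
  | succ n ih =>
    intro hn
    obtain ⟨C, hC1, hC⟩ := ih (by omega)
    -- The 1 accounts for g and the two Leibniz terms for b z and a z'; the factor 1 + K is the
    -- price of raising the order of the weight from n to n + 1 while gaining μ.
    set R : ℝ := (1 + 2 * (2 ^ n * K * C)) * (1 + K) with hR
    have hR0 : 0 ≤ R := by positivity
    -- C serves the derivatives already bounded, D the data at the right end, and 2R/m matches the
    -- right hand side against the margin mμ/2.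
    refine ⟨C + D + 2 * R / m, by
      have : 0 ≤ 2 * R / m := by positivity
      linarith, ?_⟩
    intro a b g z ε μ ρ β Y N l σ h hβ ha hl hρK hσ k hk x hx
    have hN := h.N_nonneg
    have hρ1 := h.one_le_rho
    have hε := h.eps_pos
    have hμ := h.mu_nonneg
    have hl1 : 1 ≤ l := by
      have h0 : 0 < l := by
        by_contra! h0
        nlinarith
      nlinarith [h.mu_le_one]
    have hRm : 0 ≤ 2 * R / m := by positivity
    rcases Nat.lt_or_ge k (n + 1) with hk' | hk'
    · refine (hC h hβ ha hl hρK hσ k (by omega) x hx).trans ?_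
      gcongr
      linarith
    obtain rfl : k = n + 1 := by omega
    set Q : ℕ → ℝ → ℝ := fun j y =>
      (l ^ j + ρ ^ j * Real.exp (-(σ * (Y - y)))) * Real.exp (-β * y) with hQ
    have hQmono : ∀ i j y, i ≤ j → Q i y ≤ Q j y := by
      intro i j y hij
      simp only [hQ]
      have h1 : l ^ i ≤ l ^ j := pow_le_pow_right₀ hl1 hij
      have h2 : ρ ^ i ≤ ρ ^ j := pow_le_pow_right₀ hρ1 hij
      gcongr
    have hQ0 : ∀ j y, 0 ≤ Q j y := fun j y => by simp only [hQ]; positivity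
    have hQexp : ∀ j y, Real.exp (-β * y) ≤ Q j y := by
      intro j y
      refine le_trans ?_ (hQmono 0 j y (Nat.zero_le _))
      simp only [hQ, pow_zero, one_mul]
      refine le_mul_of_one_le_left (by positivity) ?_
      linarith [Real.exp_pos (-(σ * (Y - y)))]
    have hQstep : ∀ y, Q n y ≤ (1 + K) * μ * Q (n + 1) y := by
      intro y
      simp only [hQ]
      have h1 : l ^ n = μ * l ^ (n + 1) := by
        rw [pow_succ, mul_comm (l ^ n), ← mul_assoc, hl, one_mul]
      have h2 : ρ ^ n ≤ K * μ * ρ ^ (n + 1) := by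
        calc ρ ^ n ≤ K * μ * ρ * ρ ^ n := le_mul_of_one_le_left (by positivity) hρK
          _ = _ := by ring
      have h3 : l ^ n ≤ (1 + K) * μ * l ^ (n + 1) := by
        rw [h1]
        have : 0 ≤ K * (μ * l ^ (n + 1)) := by positivity
        linarith
      have h4 : ρ ^ n ≤ (1 + K) * μ * ρ ^ (n + 1) := by
        have : 0 ≤ μ * ρ ^ (n + 1) := by positivity
        linarith
      calc _ ≤ ((1 + K) * μ * l ^ (n + 1) + (1 + K) * μ * ρ ^ (n + 1) *
            Real.exp (-(σ * (Y - y)))) * Real.exp (-β * y) := by gcongr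
        _ = _ := by ring
    have hlow : ∀ j ≤ n, ∀ y ∈ Icc 0 Y, |iteratedDeriv j z y| ≤ C * N * Q n y := by
      intro j hj y hy
      refine (hC h hβ ha hl hρK hσ j hj y hy).trans ?_
      exact mul_le_mul_of_nonneg_left (hQmono j n y hj) (by positivity)
    -- the right hand side of the transport equation
    have hG : ∀ y ∈ Icc 0 Y,
        |-ε * iteratedDeriv (n + 2) z y + μ * a y * iteratedDeriv (n + 1) z y| ≤
          R * μ * N * Q (n + 1) y := by
      intro y hy
      have h1 : |iteratedDeriv n (a * deriv z) y - a y * iteratedDeriv n (deriv z) y| ≤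
          2 ^ n * K * (C * N * Q n y) := by
        refine abs_iteratedDeriv_mul_sub_le (h.bdd_a.mono (by omega) le_rfl).1
          (h.contDiff_deriv_le (by omega)) (fun j hj => h.bdd_a.2 j (by omega) y)
          (mul_nonneg (by positivity) (hQ0 _ _)) (fun j hj => ?_)
        rw [← iteratedDeriv_succ']
        exact hlow (j + 1) (by omega) y hy
      rw [← iteratedDeriv_succ'] at h1
      have h2 : |iteratedDeriv n (b * z) y| ≤ 2 ^ n * K * (C * N * Q n y) :=
        abs_iteratedDeriv_mul_le (h.bdd_b.mono (by omega) le_rfl).1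
          (h.contDiff_le (by omega)) (fun j hj => h.bdd_b.2 j (by omega) y)
          (fun j hj => hlow j hj y hy)
      have h3 : |iteratedDeriv n g y| ≤ N * Q n y :=
        (h.rhs_bound n (by omega) y hy).trans (by gcongr; exact hQexp n y)
      -- The equation is first order in z^(n+1): the Leibniz term with a itself is moved to the
      -- left, and only derivatives of z up to order n remain on the right.
      have e : -ε * iteratedDeriv (n + 2) z y + μ * a y * iteratedDeriv (n + 1) z y =
          iteratedDeriv n g y - iteratedDeriv n (b * z) y -
          μ * (iteratedDeriv n (a * deriv z) y - a y * iteratedDeriv (n + 1) z y) := by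
        rw [neg_mul, h.ode (by omega) y]
        ring
      have h4 : |μ * (iteratedDeriv n (a * deriv z) y - a y * iteratedDeriv (n + 1) z y)| ≤
          1 * (2 ^ n * K * (C * N * Q n y)) := by
        rw [abs_mul, abs_of_nonneg hμ]
        exact mul_le_mul h.mu_le_one h1 (abs_nonneg _) zero_le_one
      have h5 := abs_sub (iteratedDeriv n g y - iteratedDeriv n (b * z) y)
        (μ * (iteratedDeriv n (a * deriv z) y - a y * iteratedDeriv (n + 1) z y))
      have h6 := abs_sub (iteratedDeriv n g y) (iteratedDeriv n (b * z) y)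
      rw [e]
      calc _ ≤ (1 + 2 * (2 ^ n * K * C)) * N * Q n y := by linarith
        _ ≤ (1 + 2 * (2 ^ n * K * C)) * N * ((1 + K) * μ * Q (n + 1) y) := by
          gcongr
          exact hQstep y
        _ = _ := by rw [hR]; ring
    have hzd : ∀ y, HasDerivAt (iteratedDeriv (n + 1) z) (iteratedDeriv (n + 2) z y) y := by
      intro y
      rw [iteratedDeriv_succ (n := n + 1)]
      have := (h.contDiff_le (k := n + 2) (by omega)).differentiable_iteratedDeriv (n + 1)
        (by exact_mod_cast (by omega))
      exact (this y).hasDerivAt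
    set C' : ℝ := C + D + 2 * R / m with hC'
    have hC'0 : 0 ≤ C' * N := by positivity
    have hQd : ∀ y, HasDerivAt (fun y => C' * N * Q (n + 1) y) (C' * N *
        ((ρ ^ (n + 1) * (Real.exp (-(σ * (Y - y))) * σ)) * Real.exp (-β * y) +
        (l ^ (n + 1) + ρ ^ (n + 1) * Real.exp (-(σ * (Y - y)))) *
          (Real.exp (-β * y) * (-β)))) y := by
      intro y
      have h1 : HasDerivAt (fun y => Real.exp (-(σ * (Y - y))))
          (Real.exp (-(σ * (Y - y))) * σ) y := by
        have := ((((hasDerivAt_id y).const_sub Y).const_mul σ).neg).exp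
        exact this.congr_deriv (by simp)
      have h2 : HasDerivAt (fun y => Real.exp (-β * y)) (Real.exp (-β * y) * (-β)) y := by
        have := ((hasDerivAt_id y).const_mul (-β)).exp
        exact this.congr_deriv (by simp)
      exact ((((h1.const_mul _).const_add _).mul h2).const_mul _)
    have key : ∀ s : ℝ, |s| = 1 → ∀ y ∈ Icc 0 Y,
        0 ≤ C' * N * Q (n + 1) y + s * iteratedDeriv (n + 1) z y := by
      intro s hs
      have hs' : ∀ t r : ℝ, |t| ≤ r → 0 ≤ r + s * t := fun t r h => by
        have := neg_abs_le (s * t)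
        rw [abs_mul, hs, one_mul] at this
        linarith
      refine nonneg_of_firstOrder (μ := μ) hε h.bdd_a.1.continuous
        (fun y => (hQd y).add ((hzd y).const_mul s)) (fun y hy => ?_) ?_
      · have h1 := transport_supersolution (Y := Y) (x := y) (A := l ^ (n + 1))
          (B := ρ ^ (n + 1)) hμ (ha y hy) hσ hε hβ (by positivity) (by positivity) hm.le
        have h2 := mul_le_mul_of_nonneg_left h1 hC'0
        have h3 := hs' _ _ (hG y hy)
        have h4 : R * μ * N * Q (n + 1) y ≤ C' * N * (m * μ / 2 * Q (n + 1) y) := by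
          have h5 : R ≤ C' * (m / 2) := by
            have : 2 * R / m * (m / 2) = R := by field_simp
            rw [hC', add_mul, this]
            have : 0 ≤ (C + D) * (m / 2) := by positivity
            linarith
          have h6 : 0 ≤ μ * N * Q (n + 1) y := mul_nonneg (by positivity) (hQ0 _ _)
          nlinarith
        simp only [hQ] at h3 h4 ⊢
        linarith
      -- At Y the layer factor equals 1, so the crude bound with ρ^(n+1) suffices there.
      · refine hs' _ _ ((hD h (n + 1) hn Y ⟨by linarith [h.one_le_Y], le_rfl⟩).trans ?_)
        simp only [hQ, sub_self, mul_zero, neg_zero, Real.exp_zero, mul_one]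
        have h1 : D ≤ C' := by linarith
        have h2 : ρ ^ (n + 1) ≤ l ^ (n + 1) + ρ ^ (n + 1) := by
          have : 0 ≤ l ^ (n + 1) := by positivity
          linarith
        rw [mul_assoc (D * N)]
        gcongr
    rw [abs_le]
    constructor
    · linarith [key 1 (by simp) x hx]
    · linarith [key (-1) (by simp) x hx]

end WeightedSolution

end DerivativeEstimates

/-! ### Length scales and the two layer components. -/

section Components

/-- All barriers have this form, with β negative (left layer), positive (right layer) or zero
(remainder); only the sign or size of the last bracket has to be checked. -/
lemma L_const_mul_exp {ε μ : ℝ} {a b : ℝ → ℝ} (N β x : ℝ) :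
    L ε μ a b (fun x => N * Real.exp (β * x)) x =
      N * Real.exp (β * x) * (-ε * β ^ 2 + μ * a x * β + b x) := by
  have h : ∀ (M x : ℝ), HasDerivAt (fun x => M * Real.exp (β * x)) (M * β * Real.exp (β * x)) x := by
    intro M x
    have := (((hasDerivAt_id x).const_mul β).exp).const_mul M
    exact this.congr_deriv (by simp; ring)
  rw [L_eq_of_hasDerivAt (h N) (h (N * β) x)]
  ring

/-- Relations between the length scales `√(ε θ)` and `√(ε / θ)`. -/
lemma scale_relations {α γ ε μ θ : ℝ} (hα : 0 < α) (hγ : 0 < γ) (hε : 0 < ε) (hε1 : ε ≤ 1)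
    (hμ : 0 ≤ μ) (hμ1 : μ ≤ 1) (hθ : θ = theta α γ ε μ) :
    1 ≤ θ ∧ 0 < √(ε * θ) ∧ 1 ≤ √(θ / ε) ∧ ε * √(θ / ε) = √(ε * θ) ∧
      √(ε * θ) * √(θ / ε) = θ ∧ √(ε * θ) ^ 2 = ε * θ ∧ √(θ / ε) ^ 2 = θ / ε ∧
      μ ≤ √(γ / α) * √(ε * θ) ∧ √(ε * θ) ≤ 1 + 1 / √(γ / α) ∧
      (1 < θ → μ = √(γ / α) * √(ε * θ)) := by
  have hθ1 : 1 ≤ θ := hθ ▸ le_max_left _ _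
  have hθ0 : 0 < θ := by linarith
  have hs : 0 < √(ε * θ) := Real.sqrt_pos.2 (by positivity)
  have hk : 0 < √(γ / α) := Real.sqrt_pos.2 (by positivity)
  have hmul : √(γ / α) * √(ε * θ) = √(γ / α * (ε * θ)) := (Real.sqrt_mul (by positivity) _).symm
  have hμθ : μ ^ 2 ≤ γ / α * (ε * θ) := by
    have h1 : α * μ ^ 2 / (γ * ε) ≤ θ := hθ ▸ le_max_right _ _
    rw [div_le_iff₀ (by positivity)] at h1
    rw [div_mul_eq_mul_div, le_div_iff₀ hα]
    linarith
  have hlarge : 1 < θ → μ = √(γ / α) * √(ε * θ) := by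
    intro h
    have h1 : θ = α * μ ^ 2 / (γ * ε) := by
      rw [hθ, theta, max_eq_right_iff]
      by_contra! h2
      rw [hθ, theta, max_eq_left h2.le] at h
      exact lt_irrefl _ h
    rw [hmul, h1, show γ / α * (ε * (α * μ ^ 2 / (γ * ε))) = μ ^ 2 by field_simp,
      Real.sqrt_sq hμ]
  refine ⟨hθ1, hs, ?_, ?_, ?_, Real.sq_sqrt (by positivity), Real.sq_sqrt (by positivity), ?_, ?_,
    hlarge⟩
  · rw [Real.one_le_sqrt, le_div_iff₀ hε]; linarith
  · rw [show ε * √(θ / ε) = √(ε ^ 2) * √(θ / ε) by rw [Real.sqrt_sq hε.le],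
      ← Real.sqrt_mul (by positivity)]
    congr 1
    field_simp
  · rw [← Real.sqrt_mul (by positivity), show ε * θ * (θ / ε) = θ ^ 2 by field_simp,
      Real.sqrt_sq hθ0.le]
  · rw [hmul]; exact Real.le_sqrt_of_sq_le hμθ
  · rcases hθ1.eq_or_lt with h | h
    · rw [← h, mul_one]
      have : √ε ≤ 1 := Real.sqrt_le_one.2 hε1
      have : 0 ≤ 1 / √(γ / α) := by positivity
      linarith
    · have h1 := hlarge h
      have : √(ε * θ) = μ / √(γ / α) := by rw [h1]; field_simp
      rw [this]
      have : μ / √(γ / α) ≤ 1 / √(γ / α) := by gcongr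
      linarith

/-- Coefficients on the line with the sign conditions valid slightly beyond `[0,1]`. -/
structure ExtendedCoeffs (α γ δ K : ℝ) (A B : ℝ → ℝ) : Prop where
  bdd_a : BddDeriv 4 K A
  bdd_b : BddDeriv 4 K B
  alpha_pos : 0 < α
  gamma_pos : 0 < γ
  delta_pos : 0 < δ
  le_a : ∀ x ∈ Icc (0 : ℝ) 1, α ≤ A x
  le_b : ∀ x ∈ Icc (0 : ℝ) 1, γ * A x ≤ B x
  le_a' : ∀ x ∈ Icc (0 : ℝ) (1 + δ), α / 2 ≤ A x
  le_b' : ∀ x ∈ Icc (0 : ℝ) (1 + δ), γ * A x / 2 + 3 * (γ * α) / 8 ≤ B x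

lemma ExtendedCoeffs.b_pos {α γ δ K : ℝ} {A B : ℝ → ℝ} (h : ExtendedCoeffs α γ δ K A B) {x : ℝ}
    (hx : x ∈ Icc (0 : ℝ) (1 + δ)) : 3 * (γ * α) / 8 ≤ B x := by
  have := h.le_b' x hx
  have h1 := h.le_a' x hx
  have := h.alpha_pos
  have := mul_nonneg h.gamma_pos.le (by linarith : 0 ≤ A x)
  linarith

/-- Makes a layer at a fixed distance harmless: its exponential absorbs the powers of ρ, uniformly
in ρ. The constant 120 is 5!. -/
lemma pow_mul_exp_neg_le {c t : ℝ} (hc : 0 < c) (ht : 0 ≤ t) {k : ℕ} (hk : k ≤ 5) :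
    t ^ k * Real.exp (-(c * t)) ≤ 120 * (1 + 1 / c) ^ 5 := by
  have h1 := Real.pow_div_factorial_le_exp (c * t) (by positivity) k
  rw [div_le_iff₀ (by positivity)] at h1
  have h2 : (k.factorial : ℝ) ≤ 120 := by
    have := Nat.factorial_le hk
    exact_mod_cast (by simpa [Nat.factorial] using this : k.factorial ≤ 120)
  have h3 : (1 / c) ^ k ≤ (1 + 1 / c) ^ 5 := by
    have hc' : 0 < 1 / c := by positivity
    calc (1 / c) ^ k ≤ (1 + 1 / c) ^ k := by gcongr; linarith
      _ ≤ (1 + 1 / c) ^ 5 := pow_le_pow_right₀ (by linarith) hk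
  have h4 : t ^ k = (1 / c) ^ k * (c * t) ^ k := by
    rw [← mul_pow]; congr 1; field_simp
  calc t ^ k * Real.exp (-(c * t)) = (1 / c) ^ k * ((c * t) ^ k * Real.exp (-(c * t))) := by
        rw [h4]; ring
    _ ≤ (1 / c) ^ k * (Real.exp (c * t) * k.factorial * Real.exp (-(c * t))) := by gcongr
    _ = (1 / c) ^ k * k.factorial := by
        rw [mul_right_comm (Real.exp (c * t)), ← Real.exp_add]; simp
    _ ≤ (1 + 1 / c) ^ 5 * 120 := by gcongr
    _ = _ := by ring

/-- Layer free solutions: derivatives live on the scale `√(ε θ)`. For `θ > 1` the solution is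
controlled beyond the right end point, up to `1 + δ`. -/
theorem abs_iteratedDeriv_le_slow {α γ δ K : ℝ} {A B : ℝ → ℝ} (hC : ExtendedCoeffs α γ δ K A B) :
    ∃ C : ℝ, 1 ≤ C ∧ ∀ {ε μ θ Y β N : ℝ} {g z : ℝ → ℝ}, 0 < ε → ε ≤ 1 → 0 ≤ μ → μ ≤ 1 →
      θ = theta α γ ε μ → (θ = 1 ∧ Y = 1 ∨ 1 < θ ∧ Y = 1 + δ) →
      ContDiff ℝ 6 z → (∀ x, L ε μ A B z x = g x) →
      0 ≤ β → β ≤ √(γ * α) * (1 / √(ε * θ)) →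
      (∀ x ∈ Icc 0 Y, |z x| ≤ N * Real.exp (-β * x)) →
      (∀ k ≤ 4, ∀ x ∈ Icc 0 Y, |iteratedDeriv k g x| ≤ N * Real.exp (-β * x)) →
      ∀ k ≤ 5, ∀ x ∈ Icc (0 : ℝ) 1,
        |iteratedDeriv k z x| ≤ C * N * (1 / √(ε * θ)) ^ k * Real.exp (-β * x) := by
  have hα := hC.alpha_pos
  have hγ := hC.gamma_pos
  have hδ := hC.delta_pos
  have hK := hC.bdd_a.nonneg
  set κ := √(γ / α) with hκ
  have hκ0 : 0 < κ := Real.sqrt_pos.2 (by positivity)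
  set K' := K + κ + 1 / κ + √(γ * α) with hK'
  have hq0 : 0 ≤ √(γ * α) := Real.sqrt_nonneg _
  have hκi : 0 < 1 / κ := by positivity
  have hK'0 : 0 ≤ K' := by positivity
  obtain ⟨C₁, hC₁1, hC₁⟩ := WeightedSolution.abs_iteratedDeriv_le hK'0
  obtain ⟨C₂, hC₂1, hC₂⟩ := WeightedSolution.abs_iteratedDeriv_le_of_transport hK'0
    (half_pos hα)
  -- Chosen so that σδ = cρ, the exponent of the layer located at 1 + δ when seen from x = 1.
  set c := α * κ / 4 * δ with hc
  have hc0 : 0 < c := by positivity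
  set H := 120 * (1 + 1 / c) ^ 5 with hH
  have hH0 : 0 ≤ H := by positivity
  refine ⟨C₁ + C₂ * ((1 + H) * (1 + 1 / κ) ^ 5), by
    have : 0 ≤ C₂ * ((1 + H) * (1 + 1 / κ) ^ 5) := by positivity
    linarith, ?_⟩
  intro ε μ θ Y β N g z hε hε1 hμ hμ1 hθ hY hz hL hβ hβs hzb hgb k hk x hx
  obtain ⟨hθ1, hs, hρ1, hερ, hsρ, hs2, hρ2, hμs, hsS, hlarge⟩ :=
    scale_relations hα hγ hε hε1 hμ hμ1 hθ
  set s := √(ε * θ)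
  set ρ := √(θ / ε)
  have hsρ' : 1 / s ≤ ρ := by
    rw [div_le_iff₀ hs]; linarith
  have hY1 : 1 ≤ Y := by rcases hY with h | h <;> linarith [h.2]
  have hw : WeightedSolution K' A B g z ε μ ρ (-β) Y N := by
    refine ⟨hC.bdd_a.mono le_rfl (by linarith), hC.bdd_b.mono le_rfl (by linarith), hz, hL, hε, hμ,
      hμ1, hρ1, hY1, ?_, ?_, ?_, hzb, hgb⟩
    · rw [mul_assoc, hερ]
      exact hμs.trans (by gcongr; linarith)
    · rw [hρ2, mul_div_cancel₀ _ hε.ne']; exact hθ1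
    · rw [abs_neg, abs_of_nonneg hβ]
      refine hβs.trans ?_
      gcongr
      linarith
  have hN := hw.N_nonneg
  -- For θ = 1 one has ρ = 1/s and the crude estimate is enough. For θ > 1, μ = κs makes the
  -- transport scale 1/μ a multiple of 1/s.
  rcases hY with ⟨h1, rfl⟩ | ⟨h1, rfl⟩
  · have hρs : ρ = 1 / s := by
      rw [eq_div_iff hs.ne', mul_comm, hsρ, h1]
    rw [← hρs]
    refine (hC₁ hw k hk x hx).trans ?_
    gcongr
    have : 0 ≤ C₂ * ((1 + H) * (1 + 1 / κ) ^ 5) := by positivity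
    linarith
  · have hμe : μ = κ * s := hlarge h1
    have hμ0 : 0 < μ := by rw [hμe]; positivity
    have hl : 1 / μ = 1 / κ * (1 / s) := by rw [hμe]; field_simp
    have hl1 : 1 ≤ 1 / μ := by rw [le_div_iff₀ hμ0]; linarith
    have hκρ : 1 ≤ K' * μ * ρ := by
      have e : K' * μ * ρ = K' * κ * θ := by rw [hμe, ← hsρ]; ring
      have h2 : 1 / κ * κ ≤ K' * κ := by gcongr; linarith
      rw [one_div_mul_cancel hκ0.ne'] at h2
      rw [e]
      nlinarith
    set σ := α / 4 * κ * ρ with hσ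
    have hσe : ε * σ = α / 2 * μ / 2 := by
      rw [hσ, hμe, ← hερ]; ring
    have hest := hC₂ hw hβ (fun y hy => hC.le_a' y hy) (mul_one_div_cancel hμ0.ne') hκρ hσe k hk x
      ⟨hx.1, by linarith [hx.2]⟩
    have hlayer : ρ ^ k * Real.exp (-(σ * (1 + δ - x))) ≤ H := by
      refine le_trans ?_ (pow_mul_exp_neg_le hc0 (zero_le_one.trans hρ1) hk)
      have hσ0 : 0 ≤ σ := by positivity
      have : c * ρ ≤ σ * (1 + δ - x) := by
        rw [hc, show α * κ / 4 * δ * ρ = σ * δ by rw [hσ]; ring]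
        exact mul_le_mul_of_nonneg_left (by linarith [hx.2]) hσ0
      exact mul_le_mul_of_nonneg_left (Real.exp_le_exp.2 (neg_le_neg this)) (by positivity)
    have hlk : (1 / μ) ^ k ≤ (1 + 1 / κ) ^ 5 * (1 / s) ^ k := by
      rw [hl, mul_pow]
      gcongr
      calc (1 / κ) ^ k ≤ (1 + 1 / κ) ^ k := by gcongr; linarith
        _ ≤ (1 + 1 / κ) ^ 5 := pow_le_pow_right₀ (by linarith) hk
    have hsum : (1 / μ) ^ k + ρ ^ k * Real.exp (-(σ * (1 + δ - x))) ≤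
        (1 + H) * ((1 + 1 / κ) ^ 5 * (1 / s) ^ k) := by
      have h2 : H ≤ H * (1 / μ) ^ k := le_mul_of_one_le_right hH0 (one_le_pow₀ hl1)
      have h3 : (1 + H) * (1 / μ) ^ k ≤ (1 + H) * ((1 + 1 / κ) ^ 5 * (1 / s) ^ k) := by gcongr
      linarith
    refine hest.trans ?_
    calc _ ≤ C₂ * N * (((1 + H) * ((1 + 1 / κ) ^ 5 * (1 / s) ^ k)) * Real.exp (-β * x)) := by
          gcongr
      _ = C₂ * ((1 + H) * (1 + 1 / κ) ^ 5) * N * (1 / s) ^ k * Real.exp (-β * x) := by ring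
      _ ≤ _ := by gcongr; linarith

lemma bddDeriv_zero {n : ℕ} {K : ℝ} (hK : 0 ≤ K) : BddDeriv n K (fun _ => 0) :=
  ⟨contDiff_const, fun k _ x => by simpa using hK⟩

/-- The left layer component. -/
theorem exists_left_layer {α γ δ K : ℝ} {A B : ℝ → ℝ} (hC : ExtendedCoeffs α γ δ K A B) :
    ∃ C : ℝ, 1 ≤ C ∧ ∀ {ε μ θ : ℝ}, 0 < ε → ε ≤ 1 → 0 ≤ μ → μ ≤ 1 → θ = theta α γ ε μ →
      ∃ w : ℝ → ℝ, ContDiff ℝ 6 w ∧ (∀ x, L ε μ A B w x = 0) ∧ w 0 = 1 ∧ (θ = 1 → w 1 = 0) ∧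
        ∀ k ≤ 5, ∀ x ∈ Icc (0 : ℝ) 1, |iteratedDeriv k w x| ≤ C * (1 / √(ε * θ)) ^ k *
          Real.exp (-(√(γ * α) / (2 * √(ε * θ))) * x) := by
  obtain ⟨C, hC1, hCb⟩ := abs_iteratedDeriv_le_slow hC
  have hα := hC.alpha_pos
  have hγ := hC.gamma_pos
  have hδ := hC.delta_pos
  refine ⟨C, hC1, ?_⟩
  intro ε μ θ hε hε1 hμ hμ1 hθ
  obtain ⟨hθ1, hs, hρ1, hερ, hsρ, hs2, hρ2, hμs, hsS, hlarge⟩ :=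
    scale_relations hα hγ hε hε1 hμ hμ1 hθ
  -- The zero end value is imposed at 1 + δ only if θ > 1; for θ = 1 it is imposed at 1 itself.
  obtain ⟨Y, hY, hY1, hYδ⟩ : ∃ Y : ℝ, (θ = 1 ∧ Y = 1 ∨ 1 < θ ∧ Y = 1 + δ) ∧ 1 ≤ Y ∧
      Y ≤ 1 + δ := by
    rcases hθ1.eq_or_lt with h | h
    · exact ⟨1, Or.inl ⟨h.symm, rfl⟩, le_rfl, by linarith⟩
    · exact ⟨1 + δ, Or.inr ⟨h, rfl⟩, by linarith, le_rfl⟩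
  have hYpos : 0 < Y := by linarith
  have hsub : Icc 0 Y ⊆ Icc 0 (1 + δ) := Icc_subset_Icc le_rfl hYδ
  have hb : ∀ x ∈ Ioo 0 Y, 0 < B x := fun x hx =>
    lt_of_lt_of_le (by positivity) (hC.b_pos (hsub (Ioo_subset_Icc_self hx)))
  obtain ⟨w, hw, hLw, hw0, hwY⟩ := exists_bvp (μ := μ) 4 hε hYpos hC.bdd_a hC.bdd_b
    (bddDeriv_zero hC.bdd_a.nonneg) hb 1 0
  have hw6 : ContDiff ℝ 6 w := by exact_mod_cast hw
  refine ⟨w, hw6, hLw, hw0, ?_, ?_⟩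
  · intro h
    rcases hY with h' | h'
    · rw [← h'.2, hwY]
    · linarith [h'.1]
  set s := √(ε * θ)
  set q := √(γ * α) with hq
  have hq0 : 0 < q := Real.sqrt_pos.2 (by positivity)
  have hq2 : q ^ 2 = γ * α := Real.sq_sqrt (by positivity)
  set β := q / (2 * s) with hβ
  have hβ0 : 0 ≤ β := by positivity
  have hβ2 : ε * β ^ 2 ≤ γ * α / 4 := by
    rw [hβ, div_pow, hq2, mul_pow, hs2]
    rw [mul_div_assoc', div_le_div_iff₀ (by positivity) (by norm_num)]
    have : 0 ≤ γ * α * ε := by positivity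
    nlinarith
  have hμβ : μ * β ≤ γ / 2 := by
    have h1 : √(γ / α) * q = γ := by
      rw [hq, ← Real.sqrt_mul (by positivity),
        show γ / α * (γ * α) = γ ^ 2 by field_simp, Real.sqrt_sq hγ.le]
    calc μ * β ≤ √(γ / α) * s * β := by gcongr
      _ = √(γ / α) * q / 2 := by rw [hβ]; field_simp
      _ = γ / 2 := by rw [h1]
  have hbar : ∀ x ∈ Icc 0 Y, |w x| ≤ 1 * Real.exp (-β * x) := by
    refine abs_le_of_barrier (a := A) (μ := μ) hε hYpos hb (hw6.of_le (by norm_num)) (by fun_prop)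
      (fun x hx => ?_) (by simp [hw0]) (by rw [hwY]; simp; positivity)
    -- The bounds εβ² ≤ γα/4 and μβ ≤ γ/2 leave at least γα/8 in view of `le_b'`. This needs the
    -- factor 2 in the rate and explains the constant 3/8.
    rw [hLw, abs_zero, L_const_mul_exp]
    refine mul_nonneg (by positivity) ?_
    have hx' := hsub (Ioo_subset_Icc_self hx)
    have h1 := hC.le_b' x hx'
    have h2 : μ * β * A x ≤ γ / 2 * A x :=
      mul_le_mul_of_nonneg_right hμβ (by linarith [hC.le_a' x hx'])
    have : 0 < γ * α := by positivity
    nlinarith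
  have := hCb (N := 1) hε hε1 hμ hμ1 hθ hY hw6 hLw hβ0 (by
    rw [hβ, mul_one_div]
    gcongr
    linarith) hbar (fun k _ x _ => by simp; positivity)
  simpa using this

/-- The right layer component. -/
theorem exists_right_layer {α γ δ K : ℝ} {A B : ℝ → ℝ} (hC : ExtendedCoeffs α γ δ K A B) :
    ∃ C : ℝ, 1 ≤ C ∧ ∀ {ε μ θ : ℝ}, 0 < ε → ε ≤ 1 → 0 ≤ μ → μ ≤ 1 → θ = theta α γ ε μ →
      ∃ w : ℝ → ℝ, ContDiff ℝ 6 w ∧ (∀ x, L ε μ A B w x = 0) ∧ w 0 = 0 ∧ w 1 = 1 ∧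
        ∀ k ≤ 5, ∀ x ∈ Icc (0 : ℝ) 1, |iteratedDeriv k w x| ≤ C * √(θ / ε) ^ k *
          Real.exp (-(√(γ * α * θ) / √ε) * (1 - x)) := by
  have hα := hC.alpha_pos
  have hγ := hC.gamma_pos
  have hδ := hC.delta_pos
  have hK := hC.bdd_a.nonneg
  have hκ0 : 0 < √(γ / α) := Real.sqrt_pos.2 (by positivity)
  set q := √(γ * α) with hq
  have hq0 : 0 < q := Real.sqrt_pos.2 (by positivity)
  have hq2 : q ^ 2 = γ * α := Real.sq_sqrt (by positivity)
  obtain ⟨C, hC1, hCb⟩ := WeightedSolution.abs_iteratedDeriv_le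
    (by positivity : 0 ≤ K + √(γ / α) + q)
  refine ⟨C, hC1, ?_⟩
  intro ε μ θ hε hε1 hμ hμ1 hθ
  obtain ⟨hθ1, hs, hρ1, hερ, hsρ, hs2, hρ2, hμs, hsS, hlarge⟩ :=
    scale_relations hα hγ hε hε1 hμ hμ1 hθ
  have hsub : Icc (0 : ℝ) 1 ⊆ Icc 0 (1 + δ) := Icc_subset_Icc le_rfl (by linarith)
  have hb : ∀ x ∈ Ioo (0 : ℝ) 1, 0 < B x := fun x hx =>
    lt_of_lt_of_le (by positivity) (hC.b_pos (hsub (Ioo_subset_Icc_self hx)))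
  obtain ⟨w, hw, hLw, hw0, hw1⟩ := exists_bvp (μ := μ) 4 hε one_pos hC.bdd_a hC.bdd_b
    (bddDeriv_zero hK) hb 0 1
  have hw6 : ContDiff ℝ 6 w := by exact_mod_cast hw
  refine ⟨w, hw6, hLw, hw0, hw1, ?_⟩
  have hrate : √(γ * α * θ) / √ε = q * √(θ / ε) := by
    rw [Real.sqrt_mul (by positivity), Real.sqrt_div (by linarith), mul_div_assoc]
  rw [hrate]
  set ρ := √(θ / ε)
  set β := q * ρ with hβ
  have hβ0 : 0 ≤ β := by positivity
  have hβ2 : ε * β ^ 2 = γ * α * θ := by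
    rw [hβ, mul_pow, hq2, hρ2]; field_simp
  have hexp : ∀ x, Real.exp (-β) * Real.exp (β * x) = Real.exp (-β * (1 - x)) := fun x => by
    rw [← Real.exp_add]; congr 1; ring
  have hbar : ∀ x ∈ Icc (0 : ℝ) 1, |w x| ≤ Real.exp (-β) * Real.exp (β * x) := by
    refine abs_le_of_barrier (a := A) (μ := μ) hε one_pos hb (hw6.of_le (by norm_num))
      (by fun_prop) (fun x hx => ?_) (by rw [hw0]; simp; positivity)
      (by rw [hw1, hexp]; simp)
    rw [hLw, abs_zero, L_const_mul_exp]
    refine mul_nonneg (by positivity) ?_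
    have hx' := Ioo_subset_Icc_self hx
    have ha1 := hC.le_a x hx'
    have hb1 := hC.le_b x hx'
    have hb2 : γ * α ≤ γ * A x := by gcongr
    have hb3 : 0 < γ * α := by positivity
    rw [neg_mul, hβ2]
    -- For θ = 1 the reaction term pays for εβ² = γα; for θ > 1 the convection does, since μβ = γθ
    -- and a ≥ α.
    rcases hθ1.eq_or_lt with h | h
    · rw [← h]
      have : 0 ≤ μ * A x * β := mul_nonneg (mul_nonneg hμ (by linarith)) hβ0
      linarith
    · have hμβ : μ * β = γ * θ := by
        have h1 : √(γ / α) * q = γ := by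
          rw [hq, ← Real.sqrt_mul (by positivity),
            show γ / α * (γ * α) = γ ^ 2 by field_simp, Real.sqrt_sq hγ.le]
        calc μ * β = √(γ / α) * q * (√(ε * θ) * ρ) := by rw [hlarge h, hβ]; ring
          _ = γ * θ := by rw [h1, hsρ]
      have e : μ * A x * β = A x * (γ * θ) := by rw [← hμβ]; ring
      rw [e]
      have : α * (γ * θ) ≤ A x * (γ * θ) := by gcongr
      linarith
  have hws : WeightedSolution (K + √(γ / α) + q) A B (fun _ => 0) w ε μ ρ β 1
      (Real.exp (-β)) := by
    refine ⟨hC.bdd_a.mono le_rfl (by linarith), hC.bdd_b.mono le_rfl (by linarith), hw6, hLw, hε,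
      hμ, hμ1, hρ1, le_rfl, ?_, ?_, ?_, hbar, ?_⟩
    · rw [mul_assoc, hερ]
      exact hμs.trans (by gcongr; linarith)
    · rw [hρ2, mul_div_cancel₀ _ hε.ne']; exact hθ1
    · rw [abs_of_nonneg hβ0, hβ]
      gcongr
      linarith
    · intro k _ x _
      simp
      positivity
  intro k hk x hx
  refine (hCb hws k hk x hx).trans (le_of_eq ?_)
  rw [← hexp]
  ring

end Components

/-! ### The regular component. -/

section Regular

/-- s₀ solves the reduced equation, and s₁, p, q cancel the terms of order μ, μ² and ε. Counting μ
as s and ε as s², all that remains besides f has order at least three. -/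
lemma L_four_term {ε μ : ℝ} {a b f s₀ s₁ p q : ℝ → ℝ} {x : ℝ} (h₀ : ContDiff ℝ 2 s₀)
    (h₁ : ContDiff ℝ 2 s₁) (hp : ContDiff ℝ 2 p) (hq : ContDiff ℝ 2 q)
    (e₀ : b x * s₀ x = f x) (e₁ : b x * s₁ x = a x * deriv s₀ x)
    (ep : b x * p x = a x * deriv s₁ x) (eq : b x * q x = deriv (deriv s₀) x) :
    L ε μ a b (fun x => s₀ x + -μ * s₁ x + μ ^ 2 * p x + ε * q x) x =
      f x + ε * μ * deriv (deriv s₁) x + μ ^ 3 * (a x * deriv p x) -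
        ε * μ ^ 2 * deriv (deriv p) x + μ * ε * (a x * deriv q x) -
        ε ^ 2 * deriv (deriv q) x := by
  have c₁ : ContDiff ℝ 2 fun x => -μ * s₁ x := contDiff_const.mul h₁
  have cp : ContDiff ℝ 2 fun x => μ ^ 2 * p x := contDiff_const.mul hp
  have cq : ContDiff ℝ 2 fun x => ε * q x := contDiff_const.mul hq
  rw [L_add ((h₀.add c₁).add cp).contDiffAt cq.contDiffAt, L_add (h₀.add c₁).contDiffAt
    cp.contDiffAt, L_add h₀.contDiffAt c₁.contDiffAt, L_const_mul, L_const_mul, L_const_mul]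
  simp only [L]
  linear_combination e₀ - μ * e₁ + μ ^ 2 * ep + ε * eq

/-- Source of the shape of (i): s^(3-k) is bounded for k ≤ 3, and for k > 3 it is at most ρ^(k-3).
-/
lemma cube_mul_pow_le {s S ρ : ℝ} (hs : 0 < s) (hsS : s ≤ S) (hS1 : 1 ≤ S) (hsρ : 1 / s ≤ ρ)
    (k : ℕ) : s ^ 3 * (1 / s) ^ k ≤ S ^ 3 * (1 + ρ⁻¹ ^ (3 - (k : ℤ))) := by
  have hρ0 : 0 < ρ := lt_of_lt_of_le (by positivity) hsρ
  have hz : 0 ≤ ρ⁻¹ ^ (3 - (k : ℤ)) := zpow_nonneg (inv_nonneg.2 hρ0.le) _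
  rcases Nat.lt_or_ge 3 k with h | h
  · obtain ⟨j, rfl⟩ : ∃ j, k = 3 + j := ⟨k - 3, by omega⟩
    have e1 : s ^ 3 * (1 / s) ^ (3 + j) = (1 / s) ^ j := by
      rw [pow_add, ← mul_assoc, ← mul_pow, mul_one_div_cancel hs.ne']; simp
    have e2 : ρ⁻¹ ^ (3 - ((3 + j : ℕ) : ℤ)) = ρ ^ j := by
      rw [show (3 - ((3 + j : ℕ) : ℤ)) = -(j : ℤ) by push_cast; ring, zpow_neg, zpow_natCast,
        inv_pow, inv_inv]
    rw [e1, e2]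
    have h4 : (1 / s) ^ j ≤ ρ ^ j := by
      gcongr
    have h5 : 1 ≤ S ^ 3 := one_le_pow₀ hS1
    have h6 : 0 ≤ ρ ^ j := by positivity
    nlinarith
  · have e1 : s ^ 3 * (1 / s) ^ k = s ^ (3 - k) := by
      rw [← Nat.sub_add_cancel h, pow_add, mul_assoc, ← mul_pow, mul_one_div_cancel hs.ne']
      simp
    rw [e1]
    have h4 : s ^ (3 - k) ≤ S ^ (3 - k) := by gcongr
    have h5 : S ^ (3 - k) ≤ S ^ 3 := pow_le_pow_right₀ hS1 (by omega)
    have h6 : 0 ≤ S ^ 3 * ρ⁻¹ ^ (3 - (k : ℤ)) := by positivity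
    linarith

set_option maxHeartbeats 400000 in
/-- The regular component: a three term expansion with a remainder that vanishes at both ends of
the (possibly extended) interval. -/
theorem exists_regular {α γ δ K M : ℝ} {A B f s₀ s₁ p q : ℝ → ℝ}
    (hC : ExtendedCoeffs α γ δ K A B) (h₀ : BddDeriv 6 M s₀) (h₁ : BddDeriv 6 M s₁)
    (hp : BddDeriv 6 M p) (hq : BddDeriv 6 M q)
    (e₀ : ∀ x ∈ Ioo (0 : ℝ) 1, B x * s₀ x = f x)
    (e₁ : ∀ x ∈ Ioo (0 : ℝ) 1, B x * s₁ x = A x * deriv s₀ x)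
    (ep : ∀ x ∈ Ioo (0 : ℝ) 1, B x * p x = A x * deriv s₁ x)
    (eq : ∀ x ∈ Ioo (0 : ℝ) 1, B x * q x = deriv (deriv s₀) x) :
    ∃ C : ℝ, 0 ≤ C ∧ ∀ {ε μ θ : ℝ}, 0 < ε → ε ≤ 1 → 0 ≤ μ → μ ≤ 1 → θ = theta α γ ε μ →
      ∃ v : ℝ → ℝ, ContDiff ℝ 6 v ∧ (∀ x ∈ Ioo (0 : ℝ) 1, L ε μ A B v x = f x) ∧
        ∀ k ≤ 5, ∀ x ∈ Icc (0 : ℝ) 1,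
          |iteratedDeriv k v x| ≤ C * (1 + √(ε / θ) ^ (3 - (k : ℤ))) := by
  obtain ⟨C, hC1, hCb⟩ := abs_iteratedDeriv_le_slow hC
  have hα := hC.alpha_pos
  have hγ := hC.gamma_pos
  have hδ := hC.delta_pos
  have hK := hC.bdd_a.nonneg
  have hM := h₀.nonneg
  set κ := √(γ / α) with hκ
  have hκ0 : 0 < κ := Real.sqrt_pos.2 (by positivity)
  set S := 1 + 1 / κ with hS
  have hS1 : 1 ≤ S := by
    have : 0 ≤ 1 / κ := by positivity
    linarith
  -- The summands serve the residual coefficients εμ, μ³, εμ² and ε²; the 5 in G counts the residual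
  -- terms, εμ occurring twice.
  set W := κ + κ ^ 3 + κ ^ 2 * S + S with hW
  have hW0 : 0 ≤ W := by positivity
  set M' := M + 2 ^ 4 * K * M with hM'
  have hM'0 : 0 ≤ M' := by positivity
  set b₀ := 3 * (γ * α) / 8 with hb₀
  have hb₀0 : 0 < b₀ := by positivity
  set G := 5 * (W * M') with hG
  have hG0 : 0 ≤ G := by positivity
  have hCG : 0 ≤ C * (G * (1 + 1 / b₀)) := by positivity
  refine ⟨4 * M + C * (G * (1 + 1 / b₀)) * S ^ 3, by positivity, ?_⟩
  intro ε μ θ hε hε1 hμ hμ1 hθ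
  obtain ⟨hθ1, hs, hρ1, hερ, hsρ, hs2, hρ2, hμs, hsS, hlarge⟩ :=
    scale_relations hα hγ hε hε1 hμ hμ1 hθ
  obtain ⟨Y, hY, hY1, hYδ⟩ : ∃ Y : ℝ, (θ = 1 ∧ Y = 1 ∨ 1 < θ ∧ Y = 1 + δ) ∧ 1 ≤ Y ∧
      Y ≤ 1 + δ := by
    rcases hθ1.eq_or_lt with h | h
    · exact ⟨1, Or.inl ⟨h.symm, rfl⟩, le_rfl, by linarith⟩
    · exact ⟨1 + δ, Or.inr ⟨h, rfl⟩, by linarith, le_rfl⟩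
  have hYpos : 0 < Y := by linarith
  have hsub : Icc 0 Y ⊆ Icc 0 (1 + δ) := Icc_subset_Icc le_rfl hYδ
  have hbY : ∀ x ∈ Ioo 0 Y, b₀ ≤ B x := fun x hx => hC.b_pos (hsub (Ioo_subset_Icc_self hx))
  have hb : ∀ x ∈ Ioo 0 Y, 0 < B x := fun x hx => hb₀0.trans_le (hbY x hx)
  have hinv : √(ε / θ) = (√(θ / ε))⁻¹ := by rw [← Real.sqrt_inv, inv_div]
  rw [hinv]
  set s := √(ε * θ)
  set ρ := √(θ / ε)
  have hε2 : ε ≤ s ^ 2 := by rw [hs2]; nlinarith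
  have hsS' : s ≤ S := hsS
  have hμs' : μ ≤ κ * s := hμs
  have hs4 : s ^ 4 ≤ S * s ^ 3 := by
    rw [pow_succ' s 3]; gcongr
  -- sizes of the coefficients of the residual
  have hc : ∀ t, t ≤ κ * s ^ 3 ∨ t ≤ κ ^ 3 * s ^ 3 ∨ t ≤ κ ^ 2 * S * s ^ 3 ∨ t ≤ S * s ^ 3 →
      t ≤ W * s ^ 3 := by
    intro t ht
    have h1 : 0 ≤ κ * s ^ 3 := by positivity
    have h2 : 0 ≤ κ ^ 3 * s ^ 3 := by positivity
    have h3 : 0 ≤ κ ^ 2 * S * s ^ 3 := by positivity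
    have h4 : 0 ≤ S * s ^ 3 := by positivity
    have : W * s ^ 3 = κ * s ^ 3 + κ ^ 3 * s ^ 3 + κ ^ 2 * S * s ^ 3 + S * s ^ 3 := by
      rw [hW]; ring
    rcases ht with h | h | h | h <;> linarith
  have hc1 : |-(ε * μ)| ≤ W * s ^ 3 := by
    rw [abs_neg, abs_of_nonneg (by positivity)]
    refine hc _ (Or.inl ?_)
    calc ε * μ ≤ s ^ 2 * (κ * s) := by gcongr
      _ = _ := by ring
  have hc2 : |-μ ^ 3| ≤ W * s ^ 3 := by
    rw [abs_neg, abs_of_nonneg (by positivity)]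
    refine hc _ (Or.inr (Or.inl ?_))
    rw [← mul_pow]; gcongr
  have hc3 : |ε * μ ^ 2| ≤ W * s ^ 3 := by
    rw [abs_of_nonneg (by positivity)]
    refine hc _ (Or.inr (Or.inr (Or.inl ?_)))
    calc ε * μ ^ 2 ≤ s ^ 2 * (κ * s) ^ 2 := by gcongr
      _ = κ ^ 2 * s ^ 4 := by ring
      _ ≤ κ ^ 2 * (S * s ^ 3) := by gcongr
      _ = _ := by ring
  have hc4 : |ε ^ 2| ≤ W * s ^ 3 := by
    rw [abs_of_nonneg (by positivity)]
    refine hc _ (Or.inr (Or.inr (Or.inr ?_)))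
    calc ε ^ 2 ≤ (s ^ 2) ^ 2 := by gcongr
      _ = s ^ 4 := by ring
      _ ≤ _ := hs4
  have hMM : M ≤ M' := by
    have : 0 ≤ 2 ^ 4 * K * M := by positivity
    linarith
  have hMM' : 2 ^ 4 * K * M ≤ M' := by linarith
  have hdd : ∀ {F : ℝ → ℝ}, BddDeriv 6 M F → BddDeriv 4 M' (deriv (deriv F)) := fun h =>
    h.deriv.deriv.mono le_rfl hMM
  have had : ∀ {F : ℝ → ℝ}, BddDeriv 6 M F → BddDeriv 4 M' (fun x => A x * deriv F x) := fun h =>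
    (hC.bdd_a.mul (h.deriv.mono (by norm_num) le_rfl)).mono le_rfl hMM'
  have hg := (((((hdd h₁).const_mul hc1).add ((had hp).const_mul hc2)).add
    ((hdd hp).const_mul hc3)).add ((had hq).const_mul hc1)).add ((hdd hq).const_mul hc4)
  set g : ℝ → ℝ := fun x => -(ε * μ) * deriv (deriv s₁) x + -μ ^ 3 * (A x * deriv p x) +
    ε * μ ^ 2 * deriv (deriv p) x + -(ε * μ) * (A x * deriv q x) + ε ^ 2 * deriv (deriv q) x
  have hgG : BddDeriv 4 (G * s ^ 3) g := hg.mono le_rfl (le_of_eq (by rw [hG]; ring))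
  have hGs : 0 ≤ G * s ^ 3 := by positivity
  -- The common bound K + G s³ serves only existence and does not enter the estimates.
  obtain ⟨R, hR, hLR, hR0, hRY⟩ := exists_bvp (μ := μ) 4 hε hYpos
    (hC.bdd_a.mono le_rfl (le_add_of_nonneg_right hGs))
    (hC.bdd_b.mono le_rfl (le_add_of_nonneg_right hGs))
    (hgG.mono le_rfl (le_add_of_nonneg_left hK)) hb 0 0
  have hR6 : ContDiff ℝ 6 R := by exact_mod_cast hR
  have hRb : ∀ x ∈ Icc 0 Y, |R x| ≤ G * s ^ 3 / b₀ * Real.exp (0 * x) := by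
    refine abs_le_of_barrier (a := A) (μ := μ) hε hYpos hb (hR6.of_le (by norm_num))
      (by fun_prop) (fun x hx => ?_) (by rw [hR0]; simp; positivity)
      (by rw [hRY]; simp; positivity)
    rw [hLR, L_const_mul_exp]
    refine (hgG.abs_le x).trans ?_
    simp only [zero_mul, Real.exp_zero, mul_one, mul_zero, zero_add, ne_eq, OfNat.ofNat_ne_zero,
      not_false_eq_true, zero_pow]
    rw [div_mul_eq_mul_div, le_div_iff₀ hb₀0]
    gcongr
    exact hbY x hx
  have hN : G * s ^ 3 * (1 + 1 / b₀) = G * s ^ 3 + G * s ^ 3 / b₀ := by ring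
  have hN1 : 0 ≤ G * s ^ 3 / b₀ := by positivity
  have hRk := hCb (N := G * s ^ 3 * (1 + 1 / b₀)) (β := 0) hε hε1 hμ hμ1 hθ hY hR6 hLR le_rfl
    (by positivity)
    (fun x hx => by
      have := hRb x hx
      simp only [zero_mul, Real.exp_zero, mul_one, neg_zero] at this ⊢
      linarith)
    (fun k hk x hx => by
      have := hgG.2 k hk x
      simp only [zero_mul, Real.exp_zero, mul_one, neg_zero]
      linarith)
  have hμ2 : μ ^ 2 ≤ 1 := pow_le_one₀ hμ hμ1
  have hP := ((h₀.add (h₁.const_mul (c := -μ) (C := 1) (by rwa [abs_neg, abs_of_nonneg hμ]))).add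
    (hp.const_mul (c := μ ^ 2) (C := 1) (by rwa [abs_of_nonneg (by positivity)]))).add
    (hq.const_mul (c := ε) (C := 1) (by rwa [abs_of_pos hε]))
  set P : ℝ → ℝ := fun x => s₀ x + -μ * s₁ x + μ ^ 2 * p x + ε * q x with hPdef
  have hP6 : ContDiff ℝ 6 P := by exact_mod_cast hP.1
  refine ⟨fun x => P x + R x, hP6.add hR6, fun x hx => ?_, fun k hk x hx => ?_⟩
  · rw [L_add (hP6.of_le (by norm_num)).contDiffAt (hR6.of_le (by norm_num)).contDiffAt, hLR,
      hPdef, L_four_term (h₀.1.of_le (by norm_num)) (h₁.1.of_le (by norm_num))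
        (hp.1.of_le (by norm_num)) (hq.1.of_le (by norm_num)) (e₀ x hx) (e₁ x hx) (ep x hx)
        (eq x hx)]
    ring
  · have hk6 : (k : WithTop ℕ∞) ≤ 6 := by exact_mod_cast (by omega : k ≤ 6)
    rw [iteratedDeriv_fun_add (hP6.of_le hk6).contDiffAt (hR6.of_le hk6).contDiffAt]
    have h1 : |iteratedDeriv k P x| ≤ 4 * M := by
      refine (hP.2 k (by omega) x).trans (le_of_eq (by ring))
    have h2 := hRk k hk x hx
    have hρ0 : 0 < ρ := by linarith
    have h3 := cube_mul_pow_le hs hsS' hS1 (by rw [div_le_iff₀ hs]; linarith : 1 / s ≤ ρ) k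
    have hz : 0 ≤ ρ⁻¹ ^ (3 - (k : ℤ)) := zpow_nonneg (inv_nonneg.2 hρ0.le) _
    have h4 : C * (G * s ^ 3 * (1 + 1 / b₀)) * (1 / s) ^ k * Real.exp (-0 * x) ≤
        C * (G * (1 + 1 / b₀)) * (S ^ 3 * (1 + ρ⁻¹ ^ (3 - (k : ℤ)))) := by
      rw [neg_zero, zero_mul, Real.exp_zero, mul_one]
      calc _ = C * (G * (1 + 1 / b₀)) * (s ^ 3 * (1 / s) ^ k) := by ring
        _ ≤ _ := by gcongr
    refine (abs_add_le _ _).trans ((add_le_add h1 (h2.trans h4)).trans ?_)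
    have h5 : 4 * M ≤ (4 * M) * (1 + ρ⁻¹ ^ (3 - (k : ℤ))) :=
      le_mul_of_one_le_right (by positivity) (le_add_of_nonneg_right hz)
    exact (add_le_add_left h5 _).trans (le_of_eq (by ring))

end Regular

/-! ### Extended coefficients and uniqueness of the decomposition. -/

section Assembly

lemma le_on_Icc_of_le_on_Ioo {F G : ℝ → ℝ} (hF : Continuous F) (hG : Continuous G)
    (h : ∀ x ∈ Ioo (0 : ℝ) 1, F x ≤ G x) : ∀ x ∈ Icc (0 : ℝ) 1, F x ≤ G x := by
  have h1 : closure (Ioo (0 : ℝ) 1) ⊆ {x | F x ≤ G x} :=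
    closure_minimal h (isClosed_le hF hG)
  rw [closure_Ioo zero_ne_one] at h1
  exact h1

/-- Extension of the coefficients beyond `[0,1]`. -/
theorem exists_extendedCoeffs {a b : ℝ → ℝ} {α γ : ℝ} (hα : 0 < α) (hγ : 0 < γ)
    (ha : ContDiffOn ℝ 7 a (Icc 0 1)) (hb : ContDiffOn ℝ 9 b (Icc 0 1))
    (haα : ∀ x ∈ Ioo (0 : ℝ) 1, α < a x) (hbγ : ∀ x ∈ Ioo (0 : ℝ) 1, γ * a x < b x) :
    ∃ (A B : ℝ → ℝ) (δ K : ℝ), ExtendedCoeffs α γ δ K A B ∧ BddDeriv 7 K A ∧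
      EqOn A a (Icc 0 1) ∧ EqOn B b (Icc 0 1) := by
  obtain ⟨A, K₁, hA, hAe⟩ := exists_bddDeriv_eqOn 7 (by exact_mod_cast ha)
  obtain ⟨B, K₂, hB, hBe⟩ := exists_bddDeriv_eqOn 9 (by exact_mod_cast hb)
  have hAc : Continuous A := hA.1.continuous
  have hBc : Continuous B := hB.1.continuous
  have h1 : ∀ x ∈ Icc (0 : ℝ) 1, α ≤ A x := le_on_Icc_of_le_on_Ioo continuous_const hAc
    fun x hx => by rw [hAe (Ioo_subset_Icc_self hx)]; exact (haα x hx).le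
  have h2 : ∀ x ∈ Icc (0 : ℝ) 1, γ * A x ≤ B x :=
    le_on_Icc_of_le_on_Ioo (continuous_const.mul hAc) hBc fun x hx => by
      rw [hAe (Ioo_subset_Icc_self hx), hBe (Ioo_subset_Icc_self hx)]; exact (hbγ x hx).le
  have hγα : 0 < γ * α := by positivity
  -- At the end points only γa ≤ b and α ≤ a survive. Since 3/8 < 1/2, this weaker inequality is
  -- strict there and persists beyond 1.
  have h3 : ∀ x ∈ Icc (0 : ℝ) 1, γ * A x / 2 + 3 * (γ * α) / 8 < B x := fun x hx => by
    have := mul_le_mul_of_nonneg_left (h1 x hx) hγ.le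
    linarith [h2 x hx]
  have hone : (1 : ℝ) ∈ Icc (0 : ℝ) 1 := ⟨zero_le_one, le_rfl⟩
  have hev : ∀ᶠ x in 𝓝 (1 : ℝ), α / 2 < A x ∧ γ * A x / 2 + 3 * (γ * α) / 8 < B x :=
    (hAc.continuousAt.eventually_const_lt (by linarith [h1 1 hone])).and
      (ContinuousAt.eventually_lt (by fun_prop) hBc.continuousAt (h3 1 hone))
  obtain ⟨η, hη, hball⟩ := Metric.eventually_nhds_iff.1 hev
  have hbeyond : ∀ x ∈ Icc (0 : ℝ) (1 + η / 2),
      α / 2 ≤ A x ∧ γ * A x / 2 + 3 * (γ * α) / 8 ≤ B x := by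
    intro x hx
    rcases le_total x 1 with h | h
    · exact ⟨by linarith [h1 x ⟨hx.1, h⟩], (h3 x ⟨hx.1, h⟩).le⟩
    · have := hball (y := x) (by rw [Real.dist_eq, abs_of_nonneg (by linarith)]; linarith [hx.2])
      exact ⟨this.1.le, this.2.le⟩
  have hK₁ := hA.nonneg
  have hK₂ := hB.nonneg
  exact ⟨A, B, η / 2, K₁ + K₂, ⟨hA.mono (by norm_num) (by linarith),
    hB.mono (by norm_num) (by linarith), hα, hγ, by positivity, h1, h2,
    fun x hx => (hbeyond x hx).1, fun x hx => (hbeyond x hx).2⟩,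
    hA.mono le_rfl (by linarith), hAe, hBe⟩

lemma D_eq_iteratedDeriv {z : ℝ → ℝ} (hz : ContDiff ℝ 6 z) {k : ℕ} (hk : k ≤ 5) {x : ℝ}
    (hx : x ∈ Icc (0 : ℝ) 1) : D k z x = iteratedDeriv k z x :=
  iteratedDerivWithin_eq_iteratedDeriv (uniqueDiffOn_Icc zero_lt_one)
    (hz.contDiffAt.of_le (by exact_mod_cast (by omega : k ≤ 6))) hx

/-- Uniqueness for the boundary value problem, applied to the decomposition of a solution. -/
theorem decomposition {ε μ : ℝ} {a b f u v wL wR : ℝ → ℝ} (hε : 0 < ε)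
    (hb : ∀ x ∈ Ioo (0 : ℝ) 1, 0 < b x) (hv : ContDiff ℝ 6 v) (hwL : ContDiff ℝ 6 wL)
    (hwR : ContDiff ℝ 6 wR) (hLv : ∀ x ∈ Ioo (0 : ℝ) 1, L ε μ a b v x = f x)
    (hLL : ∀ x ∈ Ioo (0 : ℝ) 1, L ε μ a b wL x = 0)
    (hLR : ∀ x ∈ Ioo (0 : ℝ) 1, L ε μ a b wR x = 0) (hL0 : wL 0 = 1) (hR0 : wR 0 = 0)
    (hR1 : wR 1 = 1) (hu : IsSolution ε μ a b f u) :
    ∀ x ∈ Icc (0 : ℝ) 1,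
      u x = v x + (u 0 - v 0) * wL x + (u 1 - v 1 - (u 0 - v 0) * wL 1) * wR x := by
  obtain ⟨hu5, huc, hLu, -, -⟩ := hu
  set c := u 0 - v 0
  set d := u 1 - v 1 - c * wL 1
  have hW : ContDiff ℝ 6 fun x => v x + c * wL x + d * wR x :=
    (hv.add (contDiff_const.mul hwL)).add (contDiff_const.mul hwR)
  have hLW : ∀ x ∈ Ioo (0 : ℝ) 1, L ε μ a b (fun x => v x + c * wL x + d * wR x) x = f x := by
    intro x hx
    have h2 : (2 : WithTop ℕ∞) ≤ 6 := by norm_num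
    rw [L_add ((hv.add (contDiff_const.mul hwL)).of_le h2).contDiffAt
      ((contDiff_const.mul hwR).of_le h2).contDiffAt,
      L_add (hv.of_le h2).contDiffAt ((contDiff_const.mul hwL).of_le h2).contDiffAt,
      L_const_mul, L_const_mul, hLv x hx, hLL x hx, hLR x hx]
    ring
  -- The maximum principle applies to both signs of the difference, which vanishes at 0 and 1; it
  -- asks only for continuity at the ends.
  have key : ∀ s : ℝ, ∀ x ∈ Icc (0 : ℝ) 1,
      0 ≤ s * u x + -s * (v x + c * wL x + d * wR x) := by
    intro s
    refine nonneg_of_L_nonneg (μ := μ) (a := a) hε one_pos hb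
      ((continuousOn_const.mul huc).add (continuous_const.mul hW.continuous).continuousOn)
      (fun x hx => ?_) ?_ ?_
    · have hux : ContDiffAt ℝ 2 u x :=
        (hu5.contDiffAt (isOpen_Ioo.mem_nhds hx)).of_le (by norm_num)
      rw [L_add (contDiffAt_const.mul hux)
        (contDiffAt_const.mul (hW.of_le (by norm_num)).contDiffAt), L_const_mul, L_const_mul,
        hLu x hx, hLW x hx]
      linarith
    · rw [hL0, hR0]
      simp only [c]
      linarith
    · rw [hR1]
      simp only [d]
      linarith
  intro x hx
  linarith [key 1 x hx, key (-1) x hx]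

end Assembly

end TwoParam

/-! ### The main theorem. -/

theorem theorem2 (a b f : ℝ → ℝ) (α γ : ℝ) (hα : 0 < α) (hγ : 0 < γ)
    (ha : ContDiffOn ℝ 7 a (Set.Icc 0 1))
    (hb : ContDiffOn ℝ 9 b (Set.Icc 0 1))
    (hf : ContDiffOn ℝ 9 f (Set.Icc 0 1))
    (haα : ∀ x ∈ Set.Ioo (0 : ℝ) 1, α < a x)
    (hbγ : ∀ x ∈ Set.Ioo (0 : ℝ) 1, γ * a x < b x) :
    ∃ C : ℝ, 0 < C ∧ ∀ ε μ θ : ℝ, 0 < ε → ε ≤ 1 → 0 ≤ μ → μ ≤ 1 →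
      θ = TwoParam.theta α γ ε μ →
      ∃ v wL wR : ℝ → ℝ,
        -- the regular component
        TwoParam.IsComponent ε μ a b f v ∧
        -- the left layer component
        (TwoParam.IsComponent ε μ a b (fun _ => 0) wL ∧ wL 0 = 1 ∧
          (μ ^ 2 ≤ γ * ε / α → wL 1 = 0)) ∧
        -- the right layer component
        (TwoParam.IsComponent ε μ a b (fun _ => 0) wR ∧ wR 0 = 0 ∧ wR 1 = 1) ∧
        -- the decomposition of the solution
        (∀ u : ℝ → ℝ, TwoParam.IsSolution ε μ a b f u → ∀ x ∈ Set.Icc (0 : ℝ) 1,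
          u x = v x + (u 0 - v 0) * wL x + (u 1 - v 1 - (u 0 - v 0) * wL 1) * wR x) ∧
        -- (i)
        (∀ k : ℕ, k ≤ 5 → ∀ x ∈ Set.Icc (0 : ℝ) 1,
          |TwoParam.D k v x| ≤ C * (1 + Real.sqrt (ε / θ) ^ (3 - (k : ℤ)))) ∧
        -- (ii)
        (∀ x ∈ Set.Icc (0 : ℝ) 1,
          |wL x| ≤ C * Real.exp (-(Real.sqrt (γ * α) / (2 * Real.sqrt (ε * θ))) * x)) ∧
        (∀ x ∈ Set.Icc (0 : ℝ) 1,
          |wR x| ≤ C * Real.exp (-(Real.sqrt (γ * α * θ) / Real.sqrt ε) * (1 - x))) ∧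
        -- (iii)
        (∀ k : ℕ, 1 ≤ k → k ≤ 5 → ∀ x ∈ Set.Icc (0 : ℝ) 1,
          |TwoParam.D k wR x| ≤ C * Real.sqrt (θ / ε) ^ k *
            Real.exp (-(Real.sqrt (γ * α * θ) / Real.sqrt ε) * (1 - x))) ∧
        -- (iv)
        (∀ k : ℕ, 1 ≤ k → k ≤ 5 → ∀ x ∈ Set.Icc (0 : ℝ) 1,
          |TwoParam.D k wL x| ≤ C * (1 / Real.sqrt (ε * θ)) ^ k * (1 + θ ^ ((k : ℤ) - 3)) *
            Real.exp (-(Real.sqrt (γ * α) / (2 * Real.sqrt (ε * θ))) * x)) := by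
  obtain ⟨A, B, δ, K, hC, hA, hAe, hBe⟩ :=
    TwoParam.exists_extendedCoeffs hα hγ ha hb haα hbγ
  have hbpos : ∀ x ∈ Set.Icc (0 : ℝ) 1, 0 < b x := fun x hx => by
    rw [← hBe hx]
    have := hC.b_pos (x := x) ⟨hx.1, by linarith [hx.2, hC.delta_pos]⟩
    exact lt_of_lt_of_le (by positivity) this
  obtain ⟨s₀, M₁, hs₀, hs₀e⟩ := TwoParam.exists_bddDeriv_eqOn 9
    (f := fun x => f x / b x) (by exact_mod_cast hf.div hb fun x hx => (hbpos x hx).ne')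
  obtain ⟨I, M₂, hI, hIe⟩ := TwoParam.exists_bddDeriv_eqOn 9
    (f := fun x => (b x)⁻¹) (by exact_mod_cast hb.inv fun x hx => (hbpos x hx).ne')
  have hBI : ∀ x ∈ Set.Ioo (0 : ℝ) 1, B x * I x = 1 := fun x hx => by
    have hx' := Set.Ioo_subset_Icc_self hx
    rw [hBe hx', hIe hx', mul_inv_cancel₀ (hbpos x hx').ne']
  -- The coefficients of the expansion are s₁ = a s₀'/b, p = a s₁'/b and q = s₀''/b, with I
  -- extending 1/b. Here s₁ is C⁷ and p is C⁶, which is where seven derivatives of a are spent.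
  have hs₁ := hA.mul ((hs₀.mono (by norm_num : 8 ≤ 9) le_rfl).deriv.mul
    (hI.mono (by norm_num : 7 ≤ 9) le_rfl))
  have hp := (hA.mono (by norm_num : 6 ≤ 7) le_rfl).mul
    (hs₁.deriv.mul (hI.mono (by norm_num : 6 ≤ 9) le_rfl))
  have hq := (hs₀.mono (by norm_num : 8 ≤ 9) le_rfl).deriv.deriv.mul
    (hI.mono (by norm_num : 6 ≤ 9) le_rfl)
  obtain ⟨M, hM₀, hM₁, hMp, hMq⟩ : ∃ M : ℝ, TwoParam.BddDeriv 6 M s₀ ∧ TwoParam.BddDeriv 6 M _ ∧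
      TwoParam.BddDeriv 6 M _ ∧ TwoParam.BddDeriv 6 M _ :=
    ⟨max (max _ _) (max _ _),
      hs₀.mono (by norm_num) ((le_max_left _ _).trans (le_max_left _ _)),
      hs₁.mono (by norm_num) ((le_max_right _ _).trans (le_max_left _ _)),
      hp.mono le_rfl ((le_max_left _ _).trans (le_max_right _ _)),
      hq.mono le_rfl ((le_max_right _ _).trans (le_max_right _ _))⟩
  obtain ⟨C₁, hC₁, hreg⟩ := TwoParam.exists_regular (f := f) hC hM₀ hM₁ hMp hMq
    (fun x hx => by
      have hx' := Set.Ioo_subset_Icc_self hx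
      rw [hBe hx', hs₀e hx', mul_div_cancel₀ _ (hbpos x hx').ne'])
    (fun x hx => by linear_combination (A x * deriv s₀ x) * hBI x hx)
    (fun x hx => by
      linear_combination (A x * deriv (fun x => A x * (deriv s₀ x * I x)) x) * hBI x hx)
    (fun x hx => by linear_combination (deriv (deriv s₀) x) * hBI x hx)
  obtain ⟨C₂, hC₂, hleft⟩ := TwoParam.exists_left_layer hC
  obtain ⟨C₃, hC₃, hright⟩ := TwoParam.exists_right_layer hC
  refine ⟨C₁ + C₂ + C₃, by positivity, ?_⟩
  intro ε μ θ hε hε1 hμ hμ1 hθ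
  obtain ⟨v, hv, hLv, hvb⟩ := hreg hε hε1 hμ hμ1 hθ
  obtain ⟨wL, hwL, hLL, hL0, hL1, hLb⟩ := hleft hε hε1 hμ hμ1 hθ
  obtain ⟨wR, hwR, hLR, hR0, hR1, hRb⟩ := hright hε hε1 hμ hμ1 hθ
  have hL : ∀ z : ℝ → ℝ, ∀ x ∈ Set.Ioo (0 : ℝ) 1,
      TwoParam.L ε μ a b z x = TwoParam.L ε μ A B z x := fun z x hx => by
    have hx' := Set.Ioo_subset_Icc_self hx
    rw [TwoParam.L, TwoParam.L, hAe hx', hBe hx']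
  have h5 : ∀ {z : ℝ → ℝ}, ContDiff ℝ 6 z → ContDiffOn ℝ 5 z (Set.Icc 0 1) := fun hz =>
    (hz.of_le (by norm_num)).contDiffOn
  have hLv' : ∀ x ∈ Set.Ioo (0 : ℝ) 1, TwoParam.L ε μ a b v x = f x := fun x hx =>
    (hL v x hx).trans (hLv x hx)
  have hLL' : ∀ x ∈ Set.Ioo (0 : ℝ) 1, TwoParam.L ε μ a b wL x = 0 := fun x hx =>
    (hL wL x hx).trans (hLL x)
  have hLR' : ∀ x ∈ Set.Ioo (0 : ℝ) 1, TwoParam.L ε μ a b wR x = 0 := fun x hx =>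
    (hL wR x hx).trans (hLR x)
  have hθ1 : 1 ≤ θ := hθ ▸ le_max_left _ _
  have hLb' : ∀ k ≤ 5, ∀ x ∈ Set.Icc (0 : ℝ) 1, |iteratedDeriv k wL x| ≤
      (C₁ + C₂ + C₃) * (1 / Real.sqrt (ε * θ)) ^ k *
        Real.exp (-(Real.sqrt (γ * α) / (2 * Real.sqrt (ε * θ))) * x) := fun k hk x hx =>
    (hLb k hk x hx).trans (by gcongr; linarith)
  have hRb' : ∀ k ≤ 5, ∀ x ∈ Set.Icc (0 : ℝ) 1, |iteratedDeriv k wR x| ≤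
      (C₁ + C₂ + C₃) * Real.sqrt (θ / ε) ^ k *
        Real.exp (-(Real.sqrt (γ * α * θ) / Real.sqrt ε) * (1 - x)) := fun k hk x hx =>
    (hRb k hk x hx).trans (by gcongr; linarith)
  refine ⟨v, wL, wR, ⟨h5 hv, hLv'⟩, ⟨⟨h5 hwL, hLL'⟩, hL0, fun h => hL1 ?_⟩,
    ⟨⟨h5 hwR, hLR'⟩, hR0, hR1⟩, fun u hu => TwoParam.decomposition hε
      (fun x hx => hbpos x (Set.Ioo_subset_Icc_self hx)) hv hwL hwR hLv' hLL' hLR' hL0 hR0 hR1 hu,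
    fun k hk x hx => ?_, fun x hx => ?_, fun x hx => ?_, fun k _ hk x hx => ?_,
    fun k _ hk x hx => ?_⟩
  · rw [hθ, TwoParam.theta, max_eq_left_iff, div_le_one (by positivity), mul_comm]
    rwa [le_div_iff₀ hα] at h
  · rw [TwoParam.D_eq_iteratedDeriv hv hk hx]
    refine (hvb k hk x hx).trans ?_
    gcongr
    linarith
  · simpa using hLb' 0 (by norm_num) x hx
  · simpa using hRb' 0 (by norm_num) x hx
  · rw [TwoParam.D_eq_iteratedDeriv hwR hk hx]
    exact hRb' k hk x hx
  · rw [TwoParam.D_eq_iteratedDeriv hwL hk hx]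
    refine (hLb' k hk x hx).trans ?_
    -- The bound already holds without the factor 1 + θ^(k-3), which is at least 1.
    have hz : 0 ≤ θ ^ ((k : ℤ) - 3) := zpow_nonneg (by linarith) _
    refine mul_le_mul_of_nonneg_right ?_ (Real.exp_pos _).le
    exact le_mul_of_one_le_right (by positivity) (by linarith)
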